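/- For $\theta\in[0,1]$ and $r\in\mathbb{R}$ let $e_\theta=(\cos 2\pi\theta,\sin 2\pi\theta)$ and let $\ell_{\theta,r}=\{z\in\mathbb{R}^2: z\cdot e_\theta=r\}$. For $q=(\theta,r)\in[0,1]\times\mathbb{R}$ and $\delta>0$ let $T_q(\delta)=\{z\in\mathbb{R}^2:\operatorname{dist}(z,\ell_{\theta,r})\le\delta\}$ be the closed $\delta$-tube around $\ell_{\theta,r}$. For a finite Borel measure $\mu$ on the closed unit disc $B(1)\subset\mathbb{R}^2$ centred at the origin, and a finite Borel measure $\nu$ on $[0,1]\times\mathbb{R}$, put $$\mathcal{I}_\delta(\mu,\nu)=(\mu\times\nu)\big(\{(p,q):p\in T_q(\delta)\}\big),$$ and for $s\in(0,2)$ write $I_s(\sigma)=\iint|x-y|^{-s}\,d\sigma(x)\,d\sigma(y)\in[0,\infty]$ for the $s$-dimensional Riesz energy of a finite Borel measure $\sigma$ on $\mathbb{R}^2$ (with $|x-y|^{-s}=\infty$ when $x=y$). **Theorem.** For every $t\in(1,2)$ there is a constant $C_t\in(0,\infty)$, depending only on $t$, such that the following holds. Let $c\in(0,1)$, let $\delta\in(0,c/7]$,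 let $\mu$ be a finite Borel measure on $B(1)$, and let $\nu$ be a finite Borel measure on $[c,1-c]\times[-1,1]$. Then $$\mathcal{I}_\delta(\mu,\nu)\le C_t\,\delta\,\sqrt{I_{3-t}(\mu)\,I_t(\nu)},$$ with the convention $0\cdot\infty=0$ on the right-hand side. -/

import Mathlib

open MeasureTheory
open scoped ENNReal NNReal

noncomputable section

/-- The plane `ℝ²` with its Euclidean norm. It also serves as the space of line parameters
`q = (θ, r)`, with `θ = q 0` and `r = q 1`. -/
abbrev Plane : Type := EuclideanSpace ℝ (Fin 2)

/-- The unit vector `e_θ = (cos 2πθ, sin 2πθ)`. -/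
def dirVec (θ : ℝ) : Plane :=
  !₂[Real.cos (2 * Real.pi * θ), Real.sin (2 * Real.pi * θ)]

/-- The orthogonal projection `π_θ(z) = z · e_θ`. -/
def orthProj (θ : ℝ) (z : Plane) : ℝ := inner ℝ z (dirVec θ)

/-- The line `ℓ_q = π_θ⁻¹{r}` with parameter `q = (θ, r)`. -/
def paramLine (q : Plane) : Set Plane := orthProj (q 0) ⁻¹' {q 1}

/-- The tube `T_q(δ)`: the closed `δ`-neighbourhood of the line `ℓ_q`. -/
def deltaTube (q : Plane) (δ : ℝ) : Set Plane :=
  {z | Metric.infDist z (paramLine q) ≤ δ}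

/-- The weighted incidences `(μ × ν)({(p, q) : p ∈ T_q(δ)})`. -/
def weightedIncidences (δ : ℝ) (μ ν : Measure Plane) : ℝ≥0∞ :=
  (μ.prod ν) {x : Plane × Plane | x.1 ∈ deltaTube x.2 δ}

/-- The Riesz energy `I_s(μ) = ∬ |x - y|⁻ˢ dμ(x) dμ(y)`, with values in `[0, ∞]`.
For `s > 0` the kernel is `∞` on the diagonal. -/
def rieszEnergy (s : ℝ) (μ : Measure Plane) : ℝ≥0∞ :=
  ∫⁻ x, ∫⁻ y, edist x y ^ (-s) ∂μ ∂μ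

/-- The parameter rectangle `[c, 1 - c] × [-1, 1]`. -/
def paramRect (c : ℝ) : Set Plane :=
  {q | q 0 ∈ Set.Icc c (1 - c) ∧ q 1 ∈ Set.Icc (-1 : ℝ) 1}

end

/-! The mollified X-ray transform of `μ` at scale `ρ` averages `μ` over tubes of width comparable to
`ρ`, so for `δ ≤ ρ ≤ 2δ` the incidences are at most `ρ` times its integral against `ν`.
Heuristically, the X-ray transform gains half a derivative. Finite `I_{3-t}(μ)` puts `μ` in the
Sobolev space of order `(1-t)/2`, hence its transform in order `(2-t)/2`, which is dual to the order
`(t-2)/2` given by finite `I_t(ν)`. The proof makes this duality quantitative one dyadic scale at a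
time, without Fourier analysis.

The bump kernel at scale `2⁻ᴺ` is telescoped into the bump at scale `1`, which is controlled by
total masses, and differences at scales `ρ = 2⁻ᵏ`. Each difference is the derivative of a compactly
supported function, hence has mean zero. By this cancellation (`abs_integral_kernel_le`) the square
of its `L²` norm in the line parameters is at most a multiple of `∬ ρ/(ρ² + |p-q|²) dμ dμ`
(`exists_lintegral_lineTransform_sq_le`); without it the kernel would only be `1/(ρ + |p-q|)`.

Since `ν` may be singular, the transform at `q` is first bounded by averages over a square of side
`ρ` (`sq_mul_enorm_lineTransform_le`). Cauchy–Schwarz then pairs the `L²` norm with `ρ⁻²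
(ν×ν){|q-q'| ≤ 2ρ}` (`exists_lintegral_lineTransform_le`). A second Cauchy–Schwarz, over scales with
weights `ρ^(t-2)` and `ρ^(2-t)`, leaves two dyadic sums dominated by the Riesz kernels of order
`3-t` and `t` (`exists_sum_poisson_le`, `exists_sum_near_le`). -/

/-! ### Projections, their angular derivatives, and tubes -/

/-- The derivative `∂_θ π_θ(z)` of the orthogonal projection in the angle. -/
noncomputable def tangProj (θ : ℝ) (z : Plane) : ℝ :=
  2 * Real.pi * (z 1 * Real.cos (2 * Real.pi * θ) - z 0 * Real.sin (2 * Real.pi * θ))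

lemma orthProj_eq (θ : ℝ) (z : Plane) :
    orthProj θ z = z 0 * Real.cos (2 * Real.pi * θ) + z 1 * Real.sin (2 * Real.pi * θ) := by
  simp [orthProj, dirVec, PiLp.inner_apply, Fin.sum_univ_two]
  ring

lemma orthProj_sub (θ : ℝ) (z w : Plane) : orthProj θ (z - w) = orthProj θ z - orthProj θ w := by
  simp [orthProj, inner_sub_left]

lemma hasDerivAt_two_pi_mul (θ : ℝ) : HasDerivAt (fun θ : ℝ => 2 * Real.pi * θ) (2 * Real.pi) θ := by
  simpa using (hasDerivAt_id θ).const_mul (2 * Real.pi)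

lemma hasDerivAt_orthProj (z : Plane) (θ : ℝ) :
    HasDerivAt (fun θ => orthProj θ z) (tangProj θ z) θ := by
  have h := hasDerivAt_two_pi_mul θ
  simp only [orthProj_eq]
  refine ((h.cos.const_mul (z 0)).add (h.sin.const_mul (z 1))).congr_deriv ?_
  simp only [tangProj]; ring

lemma hasDerivAt_tangProj (z : Plane) (θ : ℝ) :
    HasDerivAt (fun θ => tangProj θ z) (-(2 * Real.pi) ^ 2 * orthProj θ z) θ := by
  have h := hasDerivAt_two_pi_mul θ
  simp only [orthProj_eq, tangProj]
  refine (((h.cos.const_mul (z 1)).sub (h.sin.const_mul (z 0))).const_mul (2 * Real.pi)).congr_deriv ?_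
  ring

/-- Pythagoras in the rotated orthonormal frame: `tangProj` is `2π` times the coordinate orthogonal
to `e_θ`. -/
lemma norm_sq_eq_orthProj_tangProj (θ : ℝ) (z : Plane) :
    (2 * Real.pi) ^ 2 * ‖z‖ ^ 2 = (2 * Real.pi) ^ 2 * orthProj θ z ^ 2 + tangProj θ z ^ 2 := by
  rw [EuclideanSpace.norm_sq_eq, Fin.sum_univ_two, orthProj_eq, tangProj]
  simp only [Real.norm_eq_abs, sq_abs]
  linear_combination
    (-(2 * Real.pi) ^ 2 * (z 0 ^ 2 + z 1 ^ 2)) * Real.sin_sq_add_cos_sq (2 * Real.pi * θ)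

lemma abs_orthProj_le (θ : ℝ) (z : Plane) : |orthProj θ z| ≤ ‖z‖ := by
  apply abs_le_of_sq_le_sq _ (norm_nonneg _)
  have h := norm_sq_eq_orthProj_tangProj θ z
  have : 0 < (2 * Real.pi) ^ 2 := by positivity
  nlinarith [sq_nonneg (tangProj θ z)]

lemma abs_tangProj_le (θ : ℝ) (z : Plane) : |tangProj θ z| ≤ 2 * Real.pi * ‖z‖ := by
  apply abs_le_of_sq_le_sq _ (by positivity)
  have h := norm_sq_eq_orthProj_tangProj θ z
  rw [mul_pow]
  nlinarith [mul_nonneg (sq_nonneg (2 * Real.pi)) (sq_nonneg (orthProj θ z))]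

@[fun_prop]
lemma continuous_orthProj : Continuous fun x : ℝ × Plane => orthProj x.1 x.2 := by
  simp only [orthProj_eq]
  fun_prop

@[fun_prop]
lemma continuous_tangProj : Continuous fun x : ℝ × Plane => tangProj x.1 x.2 := by
  simp only [tangProj]
  fun_prop

lemma cos_two_pi_mul_two : Real.cos (2 * Real.pi * 2) = 1 := by
  simpa [mul_comm] using Real.cos_nat_mul_two_pi 2

lemma sin_two_pi_mul_two : Real.sin (2 * Real.pi * 2) = 0 := by
  have := Real.sin_nat_mul_pi 4
  rw [← this]; congr 1; push_cast; ring

/-- Angles will run over `[0, 2]`, since a square of side `ρ ≤ 1` based at an angle below `1` may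
stick out past `1`. Two full periods still make boundary terms cancel. -/
lemma orthProj_two (z : Plane) : orthProj 2 z = orthProj 0 z := by
  simp [orthProj_eq, cos_two_pi_mul_two, sin_two_pi_mul_two]

lemma tangProj_two (z : Plane) : tangProj 2 z = tangProj 0 z := by
  simp [tangProj, cos_two_pi_mul_two, sin_two_pi_mul_two]

lemma abs_orthProj_sub_le_of_mem_deltaTube {q z : Plane} {δ : ℝ} (h : z ∈ deltaTube q δ) :
    |orthProj (q 0) z - q 1| ≤ δ := by
  refine le_trans ?_ h
  -- Needed because `Metric.infDist` to the empty set is `0`; the witness is the foot of the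
  -- perpendicular from the origin.
  have hne : (paramLine q).Nonempty := by
    refine ⟨q 1 • dirVec (q 0), ?_⟩
    simp only [paramLine, Set.mem_preimage, Set.mem_singleton_iff, orthProj_eq, dirVec]
    simp
    linear_combination q 1 * Real.sin_sq_add_cos_sq (2 * Real.pi * q 0)
  refine (Metric.le_infDist hne).2 fun w hw => ?_
  have hw' : orthProj (q 0) w = q 1 := hw
  rw [← hw', ← orthProj_sub, dist_eq_norm]
  exact abs_orthProj_le _ _

/-! ### Cancellation in the angular integral -/

/-- An oscillatory integral over two periods of the angle: the kernel is a rescaled second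
derivative `Γ''`, and the weight `w` is smooth and periodic. -/
lemma abs_integral_kernel_le {Γ Γ₁ Γ₂ w w₁ w₂ : ℝ → ℝ} {M W ρ : ℝ}
    (hΓ : ∀ x, HasDerivAt Γ (Γ₁ x) x) (hΓ₁ : ∀ x, HasDerivAt Γ₁ (Γ₂ x) x) (hΓ₂ : Continuous Γ₂)
    (hw : ∀ x, HasDerivAt w (w₁ x) x) (hw₁ : ∀ x, HasDerivAt w₁ (w₂ x) x) (hw₂ : Continuous w₂)
    (b0 : ∀ x, |Γ x| ≤ M) (b1 : ∀ x, |x * Γ₁ x| ≤ M) (b2 : ∀ x, |x ^ 2 * Γ₂ x| ≤ M)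
    (b3 : ∀ x, |Γ₂ x| ≤ M)
    (c0 : ∀ x, |w x| ≤ W) (c2 : ∀ x, |w₂ x| ≤ W)
    (per : w 2 = w 0) (per₁ : w₁ 2 = w₁ 0) (hρ : 0 < ρ) (a : Plane) :
    |∫ θ in (0 : ℝ)..2, ρ⁻¹ * Γ₂ (orthProj θ a / ρ) * w θ|
      ≤ 8 * M * W * (ρ / (ρ ^ 2 + ‖a‖ ^ 2)) := by
  have hM : 0 ≤ M := (abs_nonneg _).trans (b0 0)
  have hW : 0 ≤ W := (abs_nonneg _).trans (c0 0)
  have hu : Continuous fun θ => orthProj θ a := by fun_prop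
  have hv : Continuous fun θ => tangProj θ a := by fun_prop
  have cw : Continuous w := continuous_iff_continuousAt.2 fun x => (hw x).continuousAt
  have cw₁ : Continuous w₁ := continuous_iff_continuousAt.2 fun x => (hw₁ x).continuousAt
  have cΓ : Continuous Γ := continuous_iff_continuousAt.2 fun x => (hΓ x).continuousAt
  have cΓ₁ : Continuous Γ₁ := continuous_iff_continuousAt.2 fun x => (hΓ₁ x).continuousAt
  -- Integration by parts in closed form: the second term of `E` is chosen so that the contributions
  -- `Γ₁ · tangProj · w₁` cancel in `E'`. By periodicity `E'` integrates to zero.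
  set E : ℝ → ℝ := fun θ => Γ₁ (orthProj θ a / ρ) * tangProj θ a * w θ
    - ρ * Γ (orthProj θ a / ρ) * w₁ θ with hE
  set E' : ℝ → ℝ := fun θ => ρ⁻¹ * Γ₂ (orthProj θ a / ρ) * tangProj θ a ^ 2 * w θ
    - (2 * Real.pi) ^ 2 * orthProj θ a * Γ₁ (orthProj θ a / ρ) * w θ
    - ρ * Γ (orthProj θ a / ρ) * w₂ θ with hE'
  have hderiv : ∀ θ, HasDerivAt E (E' θ) θ := by
    intro θ
    have hq := (hasDerivAt_orthProj a θ).div_const ρ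
    have h1 := (hΓ₁ (orthProj θ a / ρ)).comp θ hq
    have h2 := (hΓ (orthProj θ a / ρ)).comp θ hq
    refine (((h1.mul (hasDerivAt_tangProj a θ)).mul (hw θ)).sub
      ((h2.const_mul ρ).mul (hw₁ θ))).congr_deriv ?_
    simp only [hE', Function.comp, Pi.mul_apply]
    field_simp
    ring
  have cE' : Continuous E' := by simp only [hE']; fun_prop
  have hE0 : ∫ θ in (0 : ℝ)..2, E' θ = 0 := by
    rw [intervalIntegral.integral_eq_sub_of_hasDerivAt (fun θ _ => hderiv θ)
      (cE'.intervalIntegrable _ _)]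
    simp only [hE, orthProj_two, tangProj_two, per, per₁, sub_self]
  -- What remains of `‖a‖²` times the integrand after removing `(2π)⁻² E'`. Every term is `O(ρ)`,
  -- because `orthProj θ a = ρ x` with `x` the argument of `Γ`, `Γ₁`, `Γ₂`.
  set R : ℝ → ℝ := fun θ => ρ⁻¹ * Γ₂ (orthProj θ a / ρ) * orthProj θ a ^ 2 * w θ
    + orthProj θ a * Γ₁ (orthProj θ a / ρ) * w θ
    + ((2 * Real.pi) ^ 2)⁻¹ * (ρ * Γ (orthProj θ a / ρ) * w₂ θ) with hR
  have cR : Continuous R := by simp only [hR]; fun_prop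
  have hpi : 1 ≤ (2 * Real.pi) ^ 2 := by nlinarith [Real.pi_gt_three]
  have hRb : ∀ θ, |R θ| ≤ 3 * (ρ * M * W) := by
    intro θ
    set x := orthProj θ a / ρ with hx
    have hux : orthProj θ a = ρ * x := by rw [hx]; field_simp
    have e1 : |ρ⁻¹ * Γ₂ x * orthProj θ a ^ 2 * w θ| ≤ ρ * M * W := by
      rw [show ρ⁻¹ * Γ₂ x * orthProj θ a ^ 2 * w θ = ρ * (x ^ 2 * Γ₂ x) * w θ by
        rw [hux]; field_simp, abs_mul, abs_mul, abs_of_pos hρ]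
      gcongr
      exacts [b2 x, c0 θ]
    have e2 : |orthProj θ a * Γ₁ x * w θ| ≤ ρ * M * W := by
      rw [show orthProj θ a * Γ₁ x * w θ = ρ * (x * Γ₁ x) * w θ by rw [hux]; ring,
        abs_mul, abs_mul, abs_of_pos hρ]
      gcongr
      exacts [b1 x, c0 θ]
    have e3 : |((2 * Real.pi) ^ 2)⁻¹ * (ρ * Γ x * w₂ θ)| ≤ ρ * M * W := by
      rw [abs_mul, abs_of_pos (by positivity : 0 < ((2 * Real.pi) ^ 2)⁻¹), abs_mul, abs_mul,
        abs_of_pos hρ]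
      calc _ ≤ 1 * (ρ * M * W) := by
            gcongr
            exacts [inv_le_one_of_one_le₀ hpi, b0 x, c2 θ]
        _ = _ := one_mul _
    calc |R θ| ≤ |ρ⁻¹ * Γ₂ x * orthProj θ a ^ 2 * w θ| + |orthProj θ a * Γ₁ x * w θ|
          + |((2 * Real.pi) ^ 2)⁻¹ * (ρ * Γ x * w₂ θ)| := abs_add_three _ _ _
      _ ≤ _ := by linarith
  have key : ‖a‖ ^ 2 * ∫ θ in (0 : ℝ)..2, ρ⁻¹ * Γ₂ (orthProj θ a / ρ) * w θ
      = ∫ θ in (0 : ℝ)..2, R θ := by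
    have : ∀ θ, ‖a‖ ^ 2 * (ρ⁻¹ * Γ₂ (orthProj θ a / ρ) * w θ)
        = ((2 * Real.pi) ^ 2)⁻¹ * E' θ + R θ := by
      intro θ
      have h := norm_sq_eq_orthProj_tangProj θ a
      have h' : ‖a‖ ^ 2 = orthProj θ a ^ 2 + ((2 * Real.pi) ^ 2)⁻¹ * tangProj θ a ^ 2 := by
        field_simp
        field_simp at h
        linarith
      simp only [hE', hR, h']
      field_simp
      ring
    rw [← intervalIntegral.integral_const_mul]
    simp only [this]
    rw [intervalIntegral.integral_add ((cE'.const_mul _).intervalIntegrable _ _)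
      (cR.intervalIntegrable _ _), intervalIntegral.integral_const_mul, hE0]
    simp
  have hfar : ‖a‖ ^ 2 * |∫ θ in (0 : ℝ)..2, ρ⁻¹ * Γ₂ (orthProj θ a / ρ) * w θ|
      ≤ 6 * (ρ * M * W) := by
    rw [← abs_of_nonneg (sq_nonneg ‖a‖), ← abs_mul, key]
    have := intervalIntegral.norm_integral_le_of_norm_le_const (a := (0 : ℝ)) (b := 2) (f := R)
      (C := 3 * (ρ * M * W)) fun θ _ => hRb θ
    rw [Real.norm_eq_abs] at this
    norm_num at this
    linarith
  have hnear : |∫ θ in (0 : ℝ)..2, ρ⁻¹ * Γ₂ (orthProj θ a / ρ) * w θ| ≤ 2 * (ρ⁻¹ * M * W) := by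
    have := intervalIntegral.norm_integral_le_of_norm_le_const (a := (0 : ℝ)) (b := 2)
      (f := fun θ => ρ⁻¹ * Γ₂ (orthProj θ a / ρ) * w θ)
      (C := ρ⁻¹ * M * W) fun θ _ => by
        rw [Real.norm_eq_abs, abs_mul, abs_mul, abs_of_pos (inv_pos.2 hρ)]
        gcongr
        exacts [b3 _, c0 θ]
    rw [Real.norm_eq_abs] at this
    norm_num at this
    linarith
  -- The constant `8` is `6` from `hfar` plus `2` from the trivial bound `hnear` multiplied by `ρ²`.
  rw [← mul_div_assoc, le_div_iff₀ (by positivity)]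
  have hn2 : ρ ^ 2 * |∫ θ in (0 : ℝ)..2, ρ⁻¹ * Γ₂ (orthProj θ a / ρ) * w θ|
      ≤ 2 * (ρ * M * W) := by
    calc _ ≤ ρ ^ 2 * (2 * (ρ⁻¹ * M * W)) := by gcongr
      _ = _ := by field_simp
  nlinarith

lemma exists_abs_le_of_hasCompactSupport {f : ℝ → ℝ} (hf : Continuous f)
    (hc : HasCompactSupport f) : ∃ M, 0 ≤ M ∧ ∀ x, |f x| ≤ M := by
  obtain ⟨M, h⟩ := hf.bounded_above_of_compact_support hc
  exact ⟨M, (norm_nonneg _).trans (h 0), h⟩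

/-- The autocorrelation is the convolution of the reflection of `α'` with `α'`. Each of the two
factors can be integrated once within compactly supported functions, which gives the two
antiderivatives. -/
lemma exists_autocorrelation_antideriv {α : ℝ → ℝ} (hα : ContDiff ℝ 2 α)
    (hc : HasCompactSupport α) :
    ∃ Γ Γ₁ Γ₂ : ℝ → ℝ, (Γ₂ = fun x => ∫ s, deriv α (s + x) * deriv α s) ∧
      (∀ x, HasDerivAt Γ (Γ₁ x) x) ∧ (∀ x, HasDerivAt Γ₁ (Γ₂ x) x) ∧ Continuous Γ₂ ∧
      HasCompactSupport Γ ∧ HasCompactSupport Γ₁ ∧ HasCompactSupport Γ₂ := by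
  -- The sign makes `β'` the reflection of `α'`; then `Γ = β * α`, `Γ₁ = β * α'`, `Γ₂ = β' * α'`.
  set β : ℝ → ℝ := fun x => -α (-x) with hβ
  have hβ2 : ContDiff ℝ 2 β := by fun_prop
  have hβc : HasCompactSupport β := by
    have : HasCompactSupport (fun x => α (-x)) := hc.comp_homeomorph (Homeomorph.neg ℝ)
    exact this.neg
  have hα' : ContDiff ℝ 1 (deriv α) := by
    have : ContDiff ℝ (1 + 1) α := by simpa [one_add_one_eq_two] using hα
    exact ((contDiff_succ_iff_deriv).1 this).2.2
  have hdβ : deriv β = fun x => deriv α (-x) := by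
    ext x
    have h := ((hα.differentiable (by norm_num) (-x)).hasDerivAt.comp x (hasDerivAt_neg x)).neg
    rw [show (-(α ∘ Neg.neg)) = β from rfl] at h
    simpa using h.deriv
  let L := ContinuousLinearMap.mul ℝ ℝ
  have cα : Continuous α := hα.continuous
  have cα' : Continuous (deriv α) := hα'.continuous
  have cβ : Continuous β := hβ2.continuous
  have cβ' : Continuous (deriv β) := by rw [hdβ]; fun_prop
  have e2 : (fun x => ∫ s, deriv α (s + x) * deriv α s)
      = convolution (deriv β) (deriv α) L volume := by
    ext x
    rw [convolution_def, ← integral_neg_eq_self]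
    refine integral_congr_ae (Filter.Eventually.of_forall fun s => ?_)
    simp only [hdβ, L, ContinuousLinearMap.mul_apply']
    rw [mul_comm]; congr 2; ring
  have d1 : ∀ x, HasDerivAt (convolution β α L volume) (convolution β (deriv α) L volume x) x :=
    fun x => hc.hasDerivAt_convolution_right L cβ.locallyIntegrable (hα.of_le (by norm_num)) x
  have d2 : ∀ x, HasDerivAt (convolution β (deriv α) L volume)
      (convolution (deriv β) (deriv α) L volume x) x :=
    fun x => hβc.hasDerivAt_convolution_left L (hβ2.of_le (by norm_num)) cα'.locallyIntegrable x
  have c2 : Continuous (convolution (deriv β) (deriv α) L volume) :=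
    hc.deriv.continuous_convolution_right L cβ'.locallyIntegrable cα'
  have k0 := hβc.convolution (μ := volume) L hc
  have k1 := hβc.convolution (μ := volume) L hc.deriv
  have k2 := hβc.deriv.convolution (μ := volume) L hc.deriv
  exact ⟨_, _, _, e2.symm, d1, d2, c2, k0, k1, k2⟩

/-- The autocorrelation of `α'` is the second derivative of a `C²` function with compact support. -/
lemma exists_autocorrelation_primitive {α : ℝ → ℝ} (hα : ContDiff ℝ 2 α)
    (hc : HasCompactSupport α) :
    ∃ Γ Γ₁ : ℝ → ℝ, ∃ M : ℝ,
      (∀ x, HasDerivAt Γ (Γ₁ x) x) ∧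
      (∀ x, HasDerivAt Γ₁ (∫ s, deriv α (s + x) * deriv α s) x) ∧
      (Continuous fun x => ∫ s, deriv α (s + x) * deriv α s) ∧
      (∀ x, |Γ x| ≤ M) ∧ (∀ x, |x * Γ₁ x| ≤ M) ∧
      (∀ x, |x ^ 2 * ∫ s, deriv α (s + x) * deriv α s| ≤ M) ∧
      (∀ x, |∫ s, deriv α (s + x) * deriv α s| ≤ M) := by
  obtain ⟨Γ, Γ₁, Γ₂, e2, d1, d2, c2, k0, k1, k2⟩ := exists_autocorrelation_antideriv hα hc
  have f0 : Continuous Γ := continuous_iff_continuousAt.2 fun x => (d1 x).continuousAt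
  have f1 : Continuous Γ₁ := continuous_iff_continuousAt.2 fun x => (d2 x).continuousAt
  obtain ⟨M0, n0, h0⟩ := exists_abs_le_of_hasCompactSupport f0 k0
  obtain ⟨M1, n1, h1⟩ := exists_abs_le_of_hasCompactSupport (f := fun x => x * Γ₁ x)
    (continuous_id.mul f1) (k1.mul_left (f := fun x : ℝ => x) : HasCompactSupport ((fun x : ℝ => x) * Γ₁))
  have k2' : HasCompactSupport fun x => x ^ 2 * Γ₂ x :=
    k2.mono fun x hx h => hx (by simp only [h, mul_zero])
  obtain ⟨M2, n2, h2⟩ := exists_abs_le_of_hasCompactSupport (by fun_prop) k2'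
  obtain ⟨M3, n3, h3⟩ := exists_abs_le_of_hasCompactSupport c2 k2
  have l0 : M0 ≤ M0 + M1 + M2 + M3 := by linarith
  have l1 : M1 ≤ M0 + M1 + M2 + M3 := by linarith
  have l2 : M2 ≤ M0 + M1 + M2 + M3 := by linarith
  have l3 : M3 ≤ M0 + M1 + M2 + M3 := by linarith
  subst e2
  exact ⟨Γ, Γ₁, M0 + M1 + M2 + M3, d1, d2, c2, fun x => (h0 x).trans l0,
    fun x => (h1 x).trans l1, fun x => (h2 x).trans l2, fun x => (h3 x).trans l3⟩

/-! ### The mollified X-ray transform and its `L²` bound -/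

/-- The kernel `ρ⁻¹ ζ((π_θ(p) - r) / ρ) (∂_θ π_θ(p))^i` at the line parameter `x = (θ, r)`. -/
noncomputable def lineKernel (ζ : ℝ → ℝ) (i : ℕ) (ρ : ℝ) (x : ℝ × ℝ) (p : Plane) : ℝ :=
  ρ⁻¹ * ζ ((orthProj x.1 p - x.2) / ρ) * tangProj x.1 p ^ i

/-- The transform of `μ` with the kernel `lineKernel`: a mollified X-ray transform. -/
noncomputable def lineTransform (ζ : ℝ → ℝ) (i : ℕ) (ρ : ℝ) (μ : Measure Plane) (x : ℝ × ℝ) : ℝ :=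
  ∫ p, lineKernel ζ i ρ x p ∂μ

lemma continuous_lineKernel {ζ : ℝ → ℝ} (hζ : Continuous ζ) (i : ℕ) (ρ : ℝ) :
    Continuous fun y : (ℝ × ℝ) × Plane => lineKernel ζ i ρ y.1 y.2 := by
  unfold lineKernel
  fun_prop

lemma continuous_lineKernel_left {ζ : ℝ → ℝ} (hζ : Continuous ζ) (i : ℕ) (ρ : ℝ) (p : Plane) :
    Continuous fun x : ℝ × ℝ => lineKernel ζ i ρ x p := by
  unfold lineKernel
  fun_prop

lemma continuous_lineKernel_mul {ζ : ℝ → ℝ} (hζ : Continuous ζ) (i : ℕ) (ρ : ℝ) :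
    Continuous fun z : (ℝ × ℝ) × Plane × Plane =>
      lineKernel ζ i ρ z.1 z.2.1 * lineKernel ζ i ρ z.1 z.2.2 := by
  unfold lineKernel
  fun_prop

lemma measurable_lineTransform {ζ : ℝ → ℝ} (hζ : Continuous ζ) (i : ℕ) (ρ : ℝ)
    (μ : Measure Plane) [IsFiniteMeasure μ] : Measurable (lineTransform ζ i ρ μ) :=
  ((continuous_lineKernel hζ i ρ).stronglyMeasurable.integral_prod_right').measurable

lemma exists_abs_lineKernel_le {ζ : ℝ → ℝ} (hζ : Continuous ζ) (hc : HasCompactSupport ζ)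
    {ρ : ℝ} (hρ : 0 < ρ) (i : ℕ) :
    ∃ M, 0 ≤ M ∧ ∀ x (p : Plane), ‖p‖ ≤ 1 → |lineKernel ζ i ρ x p| ≤ M := by
  obtain ⟨M, h0, hM⟩ := exists_abs_le_of_hasCompactSupport hζ hc
  refine ⟨ρ⁻¹ * M * (2 * Real.pi) ^ i, by positivity, fun x p hp => ?_⟩
  have hv : |tangProj x.1 p| ≤ 2 * Real.pi :=
    (abs_tangProj_le _ _).trans (by nlinarith [Real.pi_pos])
  rw [lineKernel, abs_mul, abs_mul, abs_pow, abs_of_pos (inv_pos.2 hρ)]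
  gcongr
  exact hM _

lemma ae_norm_le_one {μ : Measure Plane} (hμ : μ (Metric.closedBall (0 : Plane) 1)ᶜ = 0) :
    ∀ᵐ p ∂μ, ‖p‖ ≤ 1 := by
  refine (measure_eq_zero_iff_ae_notMem.1 hμ).mono fun p hp => ?_
  simpa using hp

lemma integrable_lineKernel {ζ : ℝ → ℝ} (hζ : Continuous ζ) (hc : HasCompactSupport ζ)
    {ρ : ℝ} (hρ : 0 < ρ) (i : ℕ) (x : ℝ × ℝ) (μ : Measure Plane) [IsFiniteMeasure μ]
    (hμ : μ (Metric.closedBall (0 : Plane) 1)ᶜ = 0) :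
    Integrable (fun p => lineKernel ζ i ρ x p) μ := by
  obtain ⟨M, -, hM⟩ := exists_abs_lineKernel_le hζ hc hρ i
  refine Integrable.of_bound (C := M) ?_ ((ae_norm_le_one hμ).mono fun p hp => hM x p hp)
  exact ((continuous_lineKernel hζ i ρ).comp (Continuous.prodMk_right x)).aestronglyMeasurable

/-- Substituting `s = (π_θ(q) - r)/ρ` leaves an autocorrelation depending on the points only through
`π_θ(p - q)`, times an angular weight. This is the integrand of `abs_integral_kernel_le`. -/
lemma integral_lineKernel_mul (ζ : ℝ → ℝ) (i : ℕ) {ρ : ℝ} (hρ : 0 < ρ) (θ : ℝ) (p q : Plane) :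
    ∫ r, lineKernel ζ i ρ (θ, r) p * lineKernel ζ i ρ (θ, r) q
      = ρ⁻¹ * (∫ s, ζ (s + orthProj θ (p - q) / ρ) * ζ s)
        * (tangProj θ p ^ i * tangProj θ q ^ i) := by
  set g : ℝ → ℝ := fun s => ζ (s + orthProj θ (p - q) / ρ) * ζ s with hg
  have h : ∀ r, lineKernel ζ i ρ (θ, r) p * lineKernel ζ i ρ (θ, r) q
      = (ρ⁻¹ * ρ⁻¹ * (tangProj θ p ^ i * tangProj θ q ^ i)) * g ((orthProj θ q - r) / ρ) := by
    intro r
    simp only [lineKernel, hg, orthProj_sub]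
    rw [show (orthProj θ q - r) / ρ + (orthProj θ p - orthProj θ q) / ρ
      = (orthProj θ p - r) / ρ by ring]
    ring
  simp only [h]
  rw [integral_const_mul, integral_sub_left_eq_self (fun x => g (x / ρ)) volume (orthProj θ q),
    Measure.integral_comp_div, abs_of_pos hρ, smul_eq_mul]
  field_simp

/-- The constant is the bound `(2π)² · 16π²` for the second derivative when `i = 1`; it dominates
all other cases. -/
lemma exists_tangProj_weight {i : ℕ} (hi : i ≤ 1) {p q : Plane} (hp : ‖p‖ ≤ 1) (hq : ‖q‖ ≤ 1) :
    ∃ w₁ w₂ : ℝ → ℝ,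
      (∀ θ, HasDerivAt (fun θ => tangProj θ p ^ i * tangProj θ q ^ i) (w₁ θ) θ) ∧
      (∀ θ, HasDerivAt w₁ (w₂ θ) θ) ∧ Continuous w₂ ∧
      (∀ θ, |tangProj θ p ^ i * tangProj θ q ^ i| ≤ 64 * Real.pi ^ 4) ∧
      (∀ θ, |w₂ θ| ≤ 64 * Real.pi ^ 4) ∧ w₁ 2 = w₁ 0 := by
  have hpi : 1 ≤ Real.pi ^ 2 := by nlinarith [Real.pi_gt_three]
  have hv : ∀ θ, |tangProj θ p * tangProj θ q| ≤ 4 * Real.pi ^ 2 := fun θ => by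
    have h1 : |tangProj θ p| ≤ 2 * Real.pi :=
      (abs_tangProj_le _ _).trans (by nlinarith [Real.pi_pos])
    have h2 : |tangProj θ q| ≤ 2 * Real.pi :=
      (abs_tangProj_le _ _).trans (by nlinarith [Real.pi_pos])
    rw [abs_mul]
    calc _ ≤ (2 * Real.pi) * (2 * Real.pi) := by gcongr
      _ = _ := by ring
  have hu : ∀ θ, |orthProj θ p * orthProj θ q| ≤ 1 := fun θ => by
    rw [abs_mul]
    exact mul_le_one₀ ((abs_orthProj_le _ _).trans hp) (abs_nonneg _)
      ((abs_orthProj_le _ _).trans hq)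
  interval_cases i
  · refine ⟨fun _ => 0, fun _ => 0, fun θ => ?_, fun θ => hasDerivAt_const _ _,
      continuous_const, fun θ => ?_, fun θ => ?_, rfl⟩
    · simpa using hasDerivAt_const θ (1 : ℝ)
    · simp only [pow_zero, mul_one, abs_one]; nlinarith
    · simp only [abs_zero]; positivity
  · refine ⟨fun θ => -(2 * Real.pi) ^ 2 *
        (orthProj θ p * tangProj θ q + tangProj θ p * orthProj θ q),
      fun θ => -(2 * Real.pi) ^ 2 * (2 * (tangProj θ p * tangProj θ q)
        - 2 * (2 * Real.pi) ^ 2 * (orthProj θ p * orthProj θ q)),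
      fun θ => ?_, fun θ => ?_, by fun_prop, fun θ => ?_, fun θ => ?_, ?_⟩
    · simp only [pow_one]
      refine ((hasDerivAt_tangProj p θ).mul (hasDerivAt_tangProj q θ)).congr_deriv ?_
      ring
    · refine ((((hasDerivAt_orthProj p θ).mul (hasDerivAt_tangProj q θ)).add
        ((hasDerivAt_tangProj p θ).mul (hasDerivAt_orthProj q θ))).const_mul
          (-(2 * Real.pi) ^ 2)).congr_deriv ?_
      ring
    · simp only [pow_one]
      exact (hv θ).trans (by nlinarith)
    · rw [abs_mul, abs_neg, abs_of_pos (by positivity : 0 < (2 * Real.pi) ^ 2)]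
      have h : |2 * (tangProj θ p * tangProj θ q)
          - 2 * (2 * Real.pi) ^ 2 * (orthProj θ p * orthProj θ q)| ≤ 16 * Real.pi ^ 2 := by
        have h1 := abs_le.1 (hv θ)
        have h2 := abs_le.1 (hu θ)
        rw [abs_le]
        constructor <;> nlinarith
      calc _ ≤ (2 * Real.pi) ^ 2 * (16 * Real.pi ^ 2) := by gcongr
        _ = _ := by ring
    · simp only [orthProj_two, tangProj_two]

lemma exists_abs_integral_lineKernel_mul_le {α : ℝ → ℝ} (hα : ContDiff ℝ 2 α)
    (hc : HasCompactSupport α) {i : ℕ} (hi : i ≤ 1) :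
    ∃ C, 0 ≤ C ∧ ∀ ρ, 0 < ρ → ∀ p q : Plane, ‖p‖ ≤ 1 → ‖q‖ ≤ 1 →
      |∫ θ in (0 : ℝ)..2, ∫ r, lineKernel (deriv α) i ρ (θ, r) p * lineKernel (deriv α) i ρ (θ, r) q|
        ≤ C * (ρ / (ρ ^ 2 + ‖p - q‖ ^ 2)) := by
  obtain ⟨Γ, Γ₁, M, d1, d2, c2, b0, b1, b2, b3⟩ := exists_autocorrelation_primitive hα hc
  have hM : 0 ≤ M := (abs_nonneg _).trans (b0 0)
  refine ⟨8 * M * (64 * Real.pi ^ 4), by positivity, fun ρ hρ p q hp hq => ?_⟩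
  obtain ⟨w₁, w₂, e1, e2, e3, e4, e5, e6⟩ := exists_tangProj_weight hi hp hq
  simp only [integral_lineKernel_mul _ _ hρ]
  exact abs_integral_kernel_le d1 d2 c2 e1 e2 e3 b0 b1 b2 b3 e4 e5
    (by simp only [tangProj_two]) e6 hρ (p - q)

lemma lineKernel_eq_zero_of_lt {ζ : ℝ → ℝ} {R : ℝ} (hR : ∀ x, R < |x| → ζ x = 0) (hR0 : 0 ≤ R)
    {ρ : ℝ} (hρ : 0 < ρ) (hρ1 : ρ ≤ 1) (i : ℕ) {p : Plane} (hp : ‖p‖ ≤ 1) {x : ℝ × ℝ}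
    (hx : 1 + R < |x.2|) : lineKernel ζ i ρ x p = 0 := by
  have h : R < |(orthProj x.1 p - x.2) / ρ| := by
    rw [abs_div, abs_of_pos hρ, lt_div_iff₀ hρ]
    have h1 := (abs_orthProj_le x.1 p).trans hp
    have h2 : |x.2| - |orthProj x.1 p| ≤ |orthProj x.1 p - x.2| := by
      rw [abs_sub_comm]; exact abs_sub_abs_le_abs_sub _ _
    nlinarith
  rw [lineKernel, hR _ h]
  ring

lemma exists_forall_lt_abs_eq_zero {ζ : ℝ → ℝ} (hc : HasCompactSupport ζ) :
    ∃ R, 0 ≤ R ∧ ∀ x, R < |x| → ζ x = 0 := by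
  obtain ⟨R, hR⟩ := hc.isCompact.isBounded.subset_closedBall (0 : ℝ)
  refine ⟨max R 0, le_max_right _ _, fun x hx => image_eq_zero_of_notMem_tsupport fun h => ?_⟩
  have := hR h
  rw [mem_closedBall_zero_iff, Real.norm_eq_abs] at this
  exact absurd (this.trans (le_max_left _ _)) (not_le.2 hx)

/-- The `L²` bound for the X-ray transform mollified with a derivative of compact support. -/
lemma exists_lintegral_lineTransform_sq_le {α : ℝ → ℝ} (hα : ContDiff ℝ 2 α)
    (hc : HasCompactSupport α) {i : ℕ} (hi : i ≤ 1) :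
    ∃ C : ℝ, 0 ≤ C ∧ ∀ ρ, 0 < ρ → ρ ≤ 1 → ∀ (μ : Measure Plane) [IsFiniteMeasure μ],
      μ (Metric.closedBall (0 : Plane) 1)ᶜ = 0 →
      ∫⁻ x in Set.Icc (0 : ℝ) 2 ×ˢ Set.univ, ‖lineTransform (deriv α) i ρ μ x‖ₑ ^ 2
        ≤ ∫⁻ p, ∫⁻ q, ENNReal.ofReal (C * (ρ / (ρ ^ 2 + ‖p - q‖ ^ 2))) ∂μ ∂μ := by
  obtain ⟨C, hC, hbound⟩ := exists_abs_integral_lineKernel_mul_le hα hc hi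
  refine ⟨C, hC, fun ρ hρ hρ1 μ _ hμ => ?_⟩
  have cζ : Continuous (deriv α) := hα.continuous_deriv (by norm_num)
  obtain ⟨R, hR0, hR⟩ := exists_forall_lt_abs_eq_zero hc.deriv
  obtain ⟨M, hM0, hM⟩ := exists_abs_lineKernel_le cζ hc.deriv hρ i
  set J := lineTransform (deriv α) i ρ μ with hJ
  set k := lineKernel (deriv α) i ρ with hk
  have hae := ae_norm_le_one hμ
  -- The transform vanishes for `r` outside `I`, as `μ` lives on the unit disc and `ρ ≤ 1`.
  -- Truncating gives a finite measure, so bounded functions are integrable and Fubini applies.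
  set I := Set.Icc (-(1 + R)) (1 + R) with hI
  set lam : Measure (ℝ × ℝ) := (volume.restrict (Set.Icc (0 : ℝ) 2)).prod (volume.restrict I)
    with hlam
  have hJm : Measurable J := measurable_lineTransform cζ i ρ μ
  have hJ0 : ∀ x : ℝ × ℝ, x.2 ∉ I → J x = 0 := by
    intro x hx
    have hx' : 1 + R < |x.2| := by
      by_contra h
      exact hx (abs_le.1 (not_lt.1 h))
    rw [hJ, lineTransform, integral_eq_zero_of_ae]
    exact hae.mono fun p hp => lineKernel_eq_zero_of_lt hR hR0 hρ hρ1 i hp hx'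
  have hJb : ∀ x, |J x| ≤ M * μ.real Set.univ := by
    intro x
    have := norm_integral_le_of_norm_le_const (μ := μ) (f := k x)
      (hae.mono fun p hp => hM x p hp)
    exact this
  have step1 : ∫⁻ x in Set.Icc (0 : ℝ) 2 ×ˢ Set.univ, ‖J x‖ₑ ^ 2 ≤ ∫⁻ x, ‖J x‖ₑ ^ 2 ∂lam := by
    rw [hlam, Measure.prod_restrict, ← Measure.volume_eq_prod,
      ← lintegral_indicator (measurableSet_Icc.prod MeasurableSet.univ),
      ← lintegral_indicator (measurableSet_Icc.prod measurableSet_Icc)]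
    refine lintegral_mono fun x => ?_
    by_cases h : x.2 ∈ I
    · refine le_of_eq ?_
      simp only [Set.indicator, Set.mem_prod, Set.mem_univ, ← hI, h]
    · rw [Set.indicator_apply]
      simp [hJ0 x h]
  -- Opening the square lets the line parameters be integrated first, where the cancellation takes
  -- place.
  have hprod : ∀ x, J x ^ 2 = ∫ y : Plane × Plane, k x y.1 * k x y.2 ∂(μ.prod μ) := by
    intro x
    rw [integral_prod_mul, sq]
    rfl
  have hae2 : ∀ᵐ y ∂(μ.prod μ), ‖y.1‖ ≤ 1 ∧ ‖y.2‖ ≤ 1 :=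
    (Measure.quasiMeasurePreserving_fst.ae hae).and (Measure.quasiMeasurePreserving_snd.ae hae)
  have hint : Integrable (Function.uncurry fun (x : ℝ × ℝ) (y : Plane × Plane) =>
      k x y.1 * k x y.2) (lam.prod (μ.prod μ)) := by
    refine Integrable.of_bound (C := M * M) ?_ ?_
    · exact (continuous_lineKernel_mul cζ i ρ).aestronglyMeasurable
    · refine (Measure.quasiMeasurePreserving_snd.ae hae2).mono fun z hz => ?_
      rw [Function.uncurry, norm_mul]
      exact mul_le_mul (hM _ _ hz.1) (hM _ _ hz.2) (norm_nonneg _) hM0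
  have hinner : ∀ y : Plane × Plane, ‖y.1‖ ≤ 1 ∧ ‖y.2‖ ≤ 1 →
      ∫ x, k x y.1 * k x y.2 ∂lam ≤ C * (ρ / (ρ ^ 2 + ‖y.1 - y.2‖ ^ 2)) := by
    intro y hy
    have hi' : Integrable (fun x => k x y.1 * k x y.2) lam := by
      refine Integrable.of_bound (C := M * M) ?_ (Filter.Eventually.of_forall fun x => ?_)
      · exact ((continuous_lineKernel_left cζ i ρ y.1).mul
          (continuous_lineKernel_left cζ i ρ y.2)).aestronglyMeasurable
      · rw [norm_mul]
        exact mul_le_mul (hM _ _ hy.1) (hM _ _ hy.2) (norm_nonneg _) hM0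
    rw [hlam, integral_prod _ hi', integral_Icc_eq_integral_Ioc,
      ← intervalIntegral.integral_of_le (by norm_num)]
    have : ∀ θ, ∫ r in I, k (θ, r) y.1 * k (θ, r) y.2 = ∫ r, k (θ, r) y.1 * k (θ, r) y.2 := by
      intro θ
      refine setIntegral_eq_integral_of_forall_compl_eq_zero fun r hr => ?_
      have hr' : 1 + R < |r| := by
        by_contra h
        exact hr (abs_le.1 (not_lt.1 h))
      rw [hk, lineKernel_eq_zero_of_lt hR hR0 hρ hρ1 i hy.1 hr', zero_mul]
    simp only [this]
    exact (le_abs_self _).trans (hbound ρ hρ _ _ hy.1 hy.2)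
  have hmaj : Continuous fun y : Plane × Plane => C * (ρ / (ρ ^ 2 + ‖y.1 - y.2‖ ^ 2)) := by
    have : ∀ y : Plane × Plane, ρ ^ 2 + ‖y.1 - y.2‖ ^ 2 ≠ 0 := fun y => by positivity
    fun_prop (disch := assumption)
  have hmaji : Integrable (fun y : Plane × Plane => C * (ρ / (ρ ^ 2 + ‖y.1 - y.2‖ ^ 2)))
      (μ.prod μ) := by
    refine Integrable.of_bound (C := C * (ρ / ρ ^ 2)) hmaj.aestronglyMeasurable
      (Filter.Eventually.of_forall fun y => ?_)
    rw [Real.norm_of_nonneg (by positivity)]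
    gcongr
    simp
  have step2 : ∫ x, J x ^ 2 ∂lam
      ≤ ∫ y : Plane × Plane, C * (ρ / (ρ ^ 2 + ‖y.1 - y.2‖ ^ 2)) ∂(μ.prod μ) := by
    simp only [hprod]
    rw [integral_integral_swap hint]
    exact integral_mono_ae hint.swap.integral_prod_left hmaji (hae2.mono hinner)
  calc _ ≤ ∫⁻ x, ‖J x‖ₑ ^ 2 ∂lam := step1
    _ = ∫⁻ x, ENNReal.ofReal (J x ^ 2) ∂lam := by
        refine lintegral_congr fun x => ?_
        rw [← sq_abs, ENNReal.ofReal_pow (abs_nonneg _), ← Real.enorm_eq_ofReal_abs]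
    _ = ENNReal.ofReal (∫ x, J x ^ 2 ∂lam) := by
        refine (ofReal_integral_eq_lintegral_ofReal ?_
          (Filter.Eventually.of_forall fun x => sq_nonneg _)).symm
        refine Integrable.of_bound (C := (M * μ.real Set.univ) ^ 2)
          (hJm.pow_const 2).aestronglyMeasurable (Filter.Eventually.of_forall fun x => ?_)
        rw [norm_pow]
        exact pow_le_pow_left₀ (norm_nonneg _) (hJb x) 2
    _ ≤ ENNReal.ofReal
        (∫ y : Plane × Plane, C * (ρ / (ρ ^ 2 + ‖y.1 - y.2‖ ^ 2)) ∂(μ.prod μ)) :=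
        ENNReal.ofReal_le_ofReal step2
    _ = ∫⁻ y : Plane × Plane, ENNReal.ofReal (C * (ρ / (ρ ^ 2 + ‖y.1 - y.2‖ ^ 2))) ∂(μ.prod μ) :=
        ofReal_integral_eq_lintegral_ofReal hmaji
          (Filter.Eventually.of_forall fun y => by positivity)
    _ = _ := lintegral_prod _ hmaj.measurable.ennreal_ofReal.aemeasurable

/-! ### Pointwise control by averages at scale `ρ` -/

/-- One-dimensional Sobolev bound: write `f x` as `f y` minus an integral of `f'`, then integrate
over `y`. -/
lemma mul_enorm_le_lintegral_of_hasDerivAt {f f' : ℝ → ℝ} (hf : ∀ x, HasDerivAt f (f' x) x)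
    (hf' : Continuous f') {ρ : ℝ} (x : ℝ) :
    ENNReal.ofReal ρ * ‖f x‖ₑ
      ≤ ∫⁻ y in Set.Icc x (x + ρ), (‖f y‖ₑ + ENNReal.ofReal ρ * ‖f' y‖ₑ) := by
  have cf : Continuous f := continuous_iff_continuousAt.2 fun x => (hf x).continuousAt
  have hpt : ∀ y ∈ Set.Icc x (x + ρ), ‖f x‖ₑ ≤ ‖f y‖ₑ + ∫⁻ z in Set.Icc x (x + ρ), ‖f' z‖ₑ := by
    intro y hy
    have h : f x = f y - ∫ z in x..y, f' z := by
      rw [intervalIntegral.integral_eq_sub_of_hasDerivAt (fun z _ => hf z)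
        (hf'.intervalIntegrable _ _)]
      ring
    rw [h]
    refine enorm_sub_le.trans (add_le_add le_rfl ?_)
    rw [intervalIntegral.integral_of_le hy.1]
    refine (enorm_integral_le_lintegral_enorm _).trans (lintegral_mono_set ?_)
    exact Set.Ioc_subset_Icc_self.trans (Set.Icc_subset_Icc_right hy.2)
  have hvol : volume (Set.Icc x (x + ρ)) = ENNReal.ofReal ρ := by simp
  calc ENNReal.ofReal ρ * ‖f x‖ₑ = ∫⁻ _ in Set.Icc x (x + ρ), ‖f x‖ₑ := by
        rw [setLIntegral_const, hvol, mul_comm]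
    _ ≤ ∫⁻ y in Set.Icc x (x + ρ), (‖f y‖ₑ + ∫⁻ z in Set.Icc x (x + ρ), ‖f' z‖ₑ) :=
        setLIntegral_mono' measurableSet_Icc hpt
    _ = _ := by
        rw [lintegral_add_left cf.measurable.enorm, lintegral_add_left cf.measurable.enorm,
          setLIntegral_const, hvol, lintegral_const_mul _ hf'.measurable.enorm, mul_comm]

lemma hasDerivAt_lineKernel_snd {ζ : ℝ → ℝ} (hζ : Differentiable ℝ ζ) (i : ℕ) (ρ : ℝ)
    (p : Plane) (θ r : ℝ) :
    HasDerivAt (fun r => lineKernel ζ i ρ (θ, r) p)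
      (-ρ⁻¹ * lineKernel (deriv ζ) i ρ (θ, r) p) r := by
  have h1 : HasDerivAt (fun r => (orthProj θ p - r) / ρ) (-1 / ρ) r :=
    ((hasDerivAt_id r).const_sub _).div_const ρ
  have h2 := (hζ ((orthProj θ p - r) / ρ)).hasDerivAt.comp r h1
  refine ((h2.const_mul ρ⁻¹).mul_const (tangProj θ p ^ i)).congr_deriv ?_
  simp only [lineKernel]
  ring

/-- The chain rule produces one factor `tangProj`; this is why kernels with exponent `1` are needed.
One angular derivative suffices, so higher exponents never occur. -/
lemma hasDerivAt_lineKernel_fst {ζ : ℝ → ℝ} (hζ : Differentiable ℝ ζ) (ρ : ℝ)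
    (p : Plane) (θ r : ℝ) :
    HasDerivAt (fun θ => lineKernel ζ 0 ρ (θ, r) p)
      (ρ⁻¹ * lineKernel (deriv ζ) 1 ρ (θ, r) p) θ := by
  have h1 : HasDerivAt (fun θ => (orthProj θ p - r) / ρ) (tangProj θ p / ρ) θ :=
    ((hasDerivAt_orthProj p θ).sub_const r).div_const ρ
  have h2 := (hζ ((orthProj θ p - r) / ρ)).hasDerivAt.comp θ h1
  simp only [lineKernel, pow_zero, mul_one, pow_one]
  refine (h2.const_mul ρ⁻¹).congr_deriv ?_
  ring

lemma hasDerivAt_integral_of_abs_le {μ : Measure Plane} [IsFiniteMeasure μ]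
    {F F' : ℝ → Plane → ℝ} {M : ℝ} (hF : ∀ x, Integrable (F x) μ)
    (hF' : ∀ x, Integrable (F' x) μ) (hM : ∀ᵐ p ∂μ, ∀ x, |F' x p| ≤ M)
    (hd : ∀ p x, HasDerivAt (fun x => F x p) (F' x p) x) (x : ℝ) :
    HasDerivAt (fun x => ∫ p, F x p ∂μ) (∫ p, F' x p ∂μ) x :=
  (hasDerivAt_integral_of_dominated_loc_of_deriv_le (s := Set.univ) (bound := fun _ => M)
    Filter.univ_mem (Filter.Eventually.of_forall fun x => (hF x).aestronglyMeasurable) (hF x)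
    (hF' x).aestronglyMeasurable (hM.mono fun _ hp x _ => hp x) (integrable_const M)
    (Filter.Eventually.of_forall fun p x _ => hd p x)).2

section
variable {ζ : ℝ → ℝ} {ρ : ℝ} {μ : Measure Plane} [IsFiniteMeasure μ]

lemma hasDerivAt_lineTransform_snd (hζ : ContDiff ℝ 1 ζ) (hc : HasCompactSupport ζ)
    (hρ : 0 < ρ) (i : ℕ) (hμ : μ (Metric.closedBall (0 : Plane) 1)ᶜ = 0) (θ r : ℝ) :
    HasDerivAt (fun r => lineTransform ζ i ρ μ (θ, r))
      (-ρ⁻¹ * lineTransform (deriv ζ) i ρ μ (θ, r)) r := by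
  have cζ' : Continuous (deriv ζ) := hζ.continuous_deriv le_rfl
  obtain ⟨M, hM0, hM⟩ := exists_abs_lineKernel_le cζ' hc.deriv hρ i
  unfold lineTransform
  rw [← integral_const_mul]
  refine hasDerivAt_integral_of_abs_le (M := ρ⁻¹ * M)
    (fun r => integrable_lineKernel hζ.continuous hc hρ i _ μ hμ)
    (F' := fun r p => -ρ⁻¹ * lineKernel (deriv ζ) i ρ (θ, r) p)
    (fun r => (integrable_lineKernel cζ' hc.deriv hρ i _ μ hμ).const_mul _)
    ((ae_norm_le_one hμ).mono fun p hp r => ?_)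
    (fun p r => hasDerivAt_lineKernel_snd (hζ.differentiable (by norm_num)) i ρ p θ r) r
  rw [abs_mul, abs_neg, abs_of_pos (inv_pos.2 hρ)]
  gcongr
  exact hM _ p hp

lemma hasDerivAt_lineTransform_fst (hζ : ContDiff ℝ 1 ζ) (hc : HasCompactSupport ζ)
    (hρ : 0 < ρ) (hμ : μ (Metric.closedBall (0 : Plane) 1)ᶜ = 0) (θ r : ℝ) :
    HasDerivAt (fun θ => lineTransform ζ 0 ρ μ (θ, r))
      (ρ⁻¹ * lineTransform (deriv ζ) 1 ρ μ (θ, r)) θ := by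
  have cζ' : Continuous (deriv ζ) := hζ.continuous_deriv le_rfl
  obtain ⟨M, hM0, hM⟩ := exists_abs_lineKernel_le cζ' hc.deriv hρ 1
  unfold lineTransform
  rw [← integral_const_mul]
  refine hasDerivAt_integral_of_abs_le (M := ρ⁻¹ * M)
    (fun θ => integrable_lineKernel hζ.continuous hc hρ 0 _ μ hμ)
    (F' := fun θ p => ρ⁻¹ * lineKernel (deriv ζ) 1 ρ (θ, r) p)
    (fun θ => (integrable_lineKernel cζ' hc.deriv hρ 1 _ μ hμ).const_mul _)
    ((ae_norm_le_one hμ).mono fun p hp θ => ?_)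
    (fun p θ => hasDerivAt_lineKernel_fst (hζ.differentiable (by norm_num)) ρ p θ r) θ
  rw [abs_mul, abs_of_pos (inv_pos.2 hρ)]
  gcongr
  exact hM _ p hp

lemma continuous_lineTransform (hζ : Continuous ζ) (hc : HasCompactSupport ζ)
    (hρ : 0 < ρ) (i : ℕ) (hμ : μ (Metric.closedBall (0 : Plane) 1)ᶜ = 0) :
    Continuous (lineTransform ζ i ρ μ) := by
  obtain ⟨M, hM0, hM⟩ := exists_abs_lineKernel_le hζ hc hρ i
  have hk := continuous_lineKernel_left hζ i ρ
  have hm : ∀ x, AEStronglyMeasurable (fun p => lineKernel ζ i ρ x p) μ := fun x =>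
    (integrable_lineKernel hζ hc hρ i x μ hμ).aestronglyMeasurable
  have hb : ∀ x, ∀ᵐ p ∂μ, ‖lineKernel ζ i ρ x p‖ ≤ M := fun x =>
    (ae_norm_le_one hμ).mono fun p hp => hM x p hp
  exact continuous_of_dominated (F := fun x p => lineKernel ζ i ρ x p) (bound := fun _ => M)
    hm hb (integrable_const M) (Filter.Eventually.of_forall hk)

lemma mul_enorm_lineTransform_snd_le (hζ : ContDiff ℝ 1 ζ) (hc : HasCompactSupport ζ)
    (hρ : 0 < ρ) (i : ℕ) (hμ : μ (Metric.closedBall (0 : Plane) 1)ᶜ = 0) (θ r : ℝ) :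
    ENNReal.ofReal ρ * ‖lineTransform ζ i ρ μ (θ, r)‖ₑ
      ≤ ∫⁻ s in Set.Icc r (r + ρ), (‖lineTransform ζ i ρ μ (θ, s)‖ₑ
        + ‖lineTransform (deriv ζ) i ρ μ (θ, s)‖ₑ) := by
  have c := continuous_lineTransform (hζ.continuous_deriv le_rfl) hc.deriv hρ i hμ
  refine (mul_enorm_le_lintegral_of_hasDerivAt
    (fun r => hasDerivAt_lineTransform_snd hζ hc hρ i hμ θ r) (by fun_prop) r).trans_eq ?_
  refine lintegral_congr fun s => ?_
  rw [enorm_mul, enorm_neg, ← mul_assoc, Real.enorm_of_nonneg (inv_pos.2 hρ).le,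
    ← ENNReal.ofReal_mul hρ.le, mul_inv_cancel₀ hρ.ne', ENNReal.ofReal_one, one_mul]

lemma mul_enorm_lineTransform_fst_le (hζ : ContDiff ℝ 1 ζ) (hc : HasCompactSupport ζ)
    (hρ : 0 < ρ) (hμ : μ (Metric.closedBall (0 : Plane) 1)ᶜ = 0) (θ r : ℝ) :
    ENNReal.ofReal ρ * ‖lineTransform ζ 0 ρ μ (θ, r)‖ₑ
      ≤ ∫⁻ τ in Set.Icc θ (θ + ρ), (‖lineTransform ζ 0 ρ μ (τ, r)‖ₑ
        + ‖lineTransform (deriv ζ) 1 ρ μ (τ, r)‖ₑ) := by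
  have c := continuous_lineTransform (hζ.continuous_deriv le_rfl) hc.deriv hρ 1 hμ
  refine (mul_enorm_le_lintegral_of_hasDerivAt
    (fun θ => hasDerivAt_lineTransform_fst hζ hc hρ hμ θ r) (by fun_prop) θ).trans_eq ?_
  refine lintegral_congr fun s => ?_
  rw [enorm_mul, ← mul_assoc, Real.enorm_of_nonneg (inv_pos.2 hρ).le,
    ← ENNReal.ofReal_mul hρ.le, mul_inv_cancel₀ hρ.ne', ENNReal.ofReal_one, one_mul]

/-- The sum of the mollified transforms that control `lineTransform ζ 0 ρ μ` at scale `ρ`. -/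
noncomputable def lineTransformSum (ζ : ℝ → ℝ) (ρ : ℝ) (μ : Measure Plane) (x : ℝ × ℝ) : ℝ≥0∞ :=
  ‖lineTransform ζ 0 ρ μ x‖ₑ + ‖lineTransform (deriv ζ) 0 ρ μ x‖ₑ
    + (‖lineTransform (deriv ζ) 1 ρ μ x‖ₑ + ‖lineTransform (deriv (deriv ζ)) 1 ρ μ x‖ₑ)

/-- The one-dimensional bound is applied in `θ` and then in `r`. Each derivative costs `ρ⁻¹`,
matched by the side `ρ`; the mixed derivative accounts for `ζ''`. -/
lemma sq_mul_enorm_lineTransform_le (hζ : ContDiff ℝ 2 ζ) (hc : HasCompactSupport ζ)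
    (hρ : 0 < ρ) (hμ : μ (Metric.closedBall (0 : Plane) 1)ᶜ = 0) (θ r : ℝ) :
    ENNReal.ofReal ρ ^ 2 * ‖lineTransform ζ 0 ρ μ (θ, r)‖ₑ
      ≤ ∫⁻ x in Set.Icc θ (θ + ρ) ×ˢ Set.Icc r (r + ρ), lineTransformSum ζ ρ μ x := by
  have hζ1 : ContDiff ℝ 1 ζ := hζ.of_le (by norm_num)
  have hζ' : ContDiff ℝ 1 (deriv ζ) := by
    have : ContDiff ℝ (1 + 1) ζ := by simpa [one_add_one_eq_two] using hζ
    exact ((contDiff_succ_iff_deriv).1 this).2.2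
  have cζ' : Continuous (deriv ζ) := hζ'.continuous
  have cζ'' : Continuous (deriv (deriv ζ)) := hζ'.continuous_deriv le_rfl
  have m00 := measurable_lineTransform hζ.continuous 0 ρ μ
  have m10 := measurable_lineTransform cζ' 0 ρ μ
  have m11 := measurable_lineTransform cζ' 1 ρ μ
  have m21 := measurable_lineTransform cζ'' 1 ρ μ
  rw [Measure.volume_eq_prod, ← Measure.prod_restrict, lintegral_prod _ (by
    unfold lineTransformSum; fun_prop)]
  calc ENNReal.ofReal ρ ^ 2 * ‖lineTransform ζ 0 ρ μ (θ, r)‖ₑ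
      = ENNReal.ofReal ρ * (ENNReal.ofReal ρ * ‖lineTransform ζ 0 ρ μ (θ, r)‖ₑ) := by ring
    _ ≤ ENNReal.ofReal ρ * ∫⁻ τ in Set.Icc θ (θ + ρ), (‖lineTransform ζ 0 ρ μ (τ, r)‖ₑ
        + ‖lineTransform (deriv ζ) 1 ρ μ (τ, r)‖ₑ) := by
        gcongr; exact mul_enorm_lineTransform_fst_le hζ1 hc hρ hμ θ r
    _ = ∫⁻ τ in Set.Icc θ (θ + ρ), (ENNReal.ofReal ρ * ‖lineTransform ζ 0 ρ μ (τ, r)‖ₑ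
        + ENNReal.ofReal ρ * ‖lineTransform (deriv ζ) 1 ρ μ (τ, r)‖ₑ) := by
        rw [← lintegral_const_mul _ (by fun_prop)]
        simp only [mul_add]
    _ ≤ _ := by
        refine lintegral_mono fun τ => ?_
        refine (add_le_add (mul_enorm_lineTransform_snd_le hζ1 hc hρ 0 hμ τ r)
          (mul_enorm_lineTransform_snd_le hζ' hc.deriv hρ 1 hμ τ r)).trans_eq ?_
        rw [← lintegral_add_left (by fun_prop)]
        rfl

end

/-! ### Dyadic sums and Riesz kernels -/

/-- The dyadic scale `2⁻ᵏ`. -/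
noncomputable def dyadicScale (k : ℕ) : ℝ := (1 / 2) ^ k

lemma dyadicScale_pos (k : ℕ) : 0 < dyadicScale k := by unfold dyadicScale; positivity

lemma dyadicScale_le_one (k : ℕ) : dyadicScale k ≤ 1 :=
  pow_le_one₀ (by norm_num) (by norm_num)

lemma dyadicScale_succ (k : ℕ) : dyadicScale k = 2 * dyadicScale (k + 1) := by
  unfold dyadicScale; rw [pow_succ]; ring

/-- With `y = x^a` and `l = 2^a`, the increment of `y/(1+y)` from `y` to `l y` is
`(l-1)y/((1+ly)(1+y))`, and `y² ≤ 1 + x²` because `a ≤ 1`. The right side telescopes along dyadic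
scales, so sums are bounded independently of their length. -/
lemma rpow_div_one_add_sq_le_sub {a : ℝ} (ha : 0 < a) (ha1 : a ≤ 1) {x : ℝ} (hx : 0 < x) :
    x ^ a / (1 + x ^ 2) ≤ 4 * 2 ^ a / (2 ^ a - 1) *
      ((2 * x) ^ a / (1 + (2 * x) ^ a) - x ^ a / (1 + x ^ a)) := by
  have hl : 1 < (2 : ℝ) ^ a := Real.one_lt_rpow (by norm_num) ha
  rw [Real.mul_rpow (by norm_num) hx.le]
  have hy : 0 < x ^ a := Real.rpow_pos_of_pos hx a
  have hyx : (x ^ a) ^ 2 ≤ 1 + x ^ 2 := by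
    rcases le_total x 1 with h | h
    · have : x ^ a ≤ 1 := Real.rpow_le_one hx.le h ha.le
      nlinarith [sq_nonneg x]
    · have : x ^ a ≤ x := by
        simpa using Real.rpow_le_rpow_of_exponent_le h ha1
      nlinarith [pow_le_pow_left₀ hy.le this 2]
  generalize x ^ a = y at *
  generalize (2 : ℝ) ^ a = l at *
  have hl' : 0 < l - 1 := by linarith
  have e : 4 * l / (l - 1) * (l * y / (1 + l * y) - y / (1 + y))
      = 4 * l * y / ((1 + l * y) * (1 + y)) := by
    have h1 : l - 1 ≠ 0 := hl'.ne'
    have h2 : 1 + l * y ≠ 0 := by positivity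
    field_simp
    ring
  rw [e, div_le_div_iff₀ (by positivity) (by positivity)]
  have h3 : (1 + l * y) * (1 + y) ≤ 4 * l * (1 + x ^ 2) := by
    nlinarith [sq_nonneg (y - 1), sq_nonneg x, mul_pos hl' hy]
  nlinarith

lemma sum_dyadicScale_rpow_le {a : ℝ} (ha : 0 < a) (ha1 : a ≤ 1) {x : ℝ} (hx : 0 < x) (N : ℕ) :
    ∑ k ∈ Finset.range N, (dyadicScale k * x) ^ a / (1 + (dyadicScale k * x) ^ 2)
      ≤ 4 * 2 ^ a / (2 ^ a - 1) := by
  have hl : 1 < (2 : ℝ) ^ a := Real.one_lt_rpow (by norm_num) ha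
  set b : ℕ → ℝ := fun k => (2 * (dyadicScale k * x)) ^ a / (1 + (2 * (dyadicScale k * x)) ^ a)
    with hb
  have hpos : ∀ k, 0 < dyadicScale k * x := fun k => mul_pos (dyadicScale_pos k) hx
  have hstep : ∀ k, (dyadicScale k * x) ^ a / (1 + (dyadicScale k * x) ^ 2)
      ≤ 4 * 2 ^ a / (2 ^ a - 1) * (b k - b (k + 1)) := by
    intro k
    refine (rpow_div_one_add_sq_le_sub ha ha1 (hpos k)).trans_eq ?_
    simp only [hb]
    rw [← mul_assoc 2 (dyadicScale (k + 1)), ← dyadicScale_succ]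
  have hC : 0 ≤ 4 * (2 : ℝ) ^ a / (2 ^ a - 1) := by
    have : 0 < (2 : ℝ) ^ a - 1 := by linarith
    positivity
  calc _ ≤ ∑ k ∈ Finset.range N, 4 * 2 ^ a / (2 ^ a - 1) * (b k - b (k + 1)) :=
        Finset.sum_le_sum fun k _ => hstep k
    _ = 4 * 2 ^ a / (2 ^ a - 1) * (b 0 - b N) := by
        rw [← Finset.mul_sum, Finset.sum_range_sub']
    _ ≤ 4 * 2 ^ a / (2 ^ a - 1) * 1 := by
        gcongr
        have h0 : b 0 ≤ 1 := by
          simp only [hb]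
          have := hpos 0
          rw [div_le_one (by positivity)]
          linarith
        have hN : 0 ≤ b N := by
          simp only [hb]
          have := hpos N
          positivity
        linarith
    _ = _ := mul_one _

lemma edist_rpow_neg_eq {x y : Plane} (h : x ≠ y) (s : ℝ) :
    edist x y ^ (-s) = ENNReal.ofReal (‖x - y‖ ^ (-s)) := by
  rw [edist_dist, dist_eq_norm, ENNReal.ofReal_rpow_of_pos (norm_pos_iff.2 (sub_ne_zero.2 h))]

/-- On the diagonal the Riesz kernel is `∞`, so only positive distances need the real estimate. -/
lemma sum_le_mul_edist_rpow {f : ℕ → ℝ → ℝ} (hf : ∀ k d, 0 ≤ f k d) {C s : ℝ} (hC : 0 < C)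
    (hs : 0 < s) (h : ∀ N d, 0 < d → ∑ k ∈ Finset.range N, f k d ≤ C * d ^ (-s)) (N : ℕ)
    (x y : Plane) :
    ∑ k ∈ Finset.range N, ENNReal.ofReal (f k ‖x - y‖) ≤ ENNReal.ofReal C * edist x y ^ (-s) := by
  rcases eq_or_ne x y with rfl | hxy
  · rw [edist_self, ENNReal.zero_rpow_of_neg (by linarith), ENNReal.mul_top (by simpa using hC)]
    exact le_top
  · rw [edist_rpow_neg_eq hxy, ← ENNReal.ofReal_mul hC.le,
      ← ENNReal.ofReal_sum_of_nonneg fun k _ => hf k _]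
    exact ENNReal.ofReal_le_ofReal (h N _ (norm_pos_iff.2 (sub_ne_zero.2 hxy)))

/-- At `d = ‖x - y‖`, factoring out `d^(-(3-t))` leaves the telescoping sum with `a = t - 1`
evaluated at `1/d`. -/
lemma exists_sum_poisson_le {t : ℝ} (ht1 : 1 < t) (ht2 : t < 2) :
    ∃ C : ℝ, 0 < C ∧ ∀ N (x y : Plane),
      ∑ k ∈ Finset.range N, ENNReal.ofReal (dyadicScale k ^ (t - 2)
        * (dyadicScale k / (dyadicScale k ^ 2 + ‖x - y‖ ^ 2)))
        ≤ ENNReal.ofReal C * edist x y ^ (-(3 - t)) := by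
  have hl : 1 < (2 : ℝ) ^ (t - 1) := Real.one_lt_rpow (by norm_num) (by linarith)
  have hl' : 0 < (2 : ℝ) ^ (t - 1) - 1 := by linarith
  refine ⟨4 * 2 ^ (t - 1) / (2 ^ (t - 1) - 1), by positivity,
    sum_le_mul_edist_rpow (f := fun k d => dyadicScale k ^ (t - 2)
        * (dyadicScale k / (dyadicScale k ^ 2 + d ^ 2))) (fun k d => ?_) (by positivity)
        (by linarith) fun N d hd => ?_⟩
  · have := dyadicScale_pos k
    positivity
  · rw [mul_comm]
    have h := sum_dyadicScale_rpow_le (by linarith : 0 < t - 1) (by linarith) (inv_pos.2 hd) N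
    refine le_trans (le_of_eq ?_) (mul_le_mul_of_nonneg_left h (by positivity : 0 ≤ d ^ (-(3 - t))))
    rw [Finset.mul_sum]
    refine Finset.sum_congr rfl fun k _ => ?_
    have hk := dyadicScale_pos k
    rw [← div_eq_mul_inv, Real.div_rpow hk.le hd.le, show t - 1 = (t - 2) + 1 by ring,
      Real.rpow_add_one hk.ne', Real.rpow_add_one hd.ne',
      show -(3 - t) = (t - 2) - 1 by ring, Real.rpow_sub_one hd.ne']
    have : d ^ (t - 2) ≠ 0 := by positivity
    field_simp
    rw [add_comm]

lemma exists_sum_near_le {t : ℝ} (ht1 : 1 < t) (ht2 : t < 2) :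
    ∃ C : ℝ, 0 < C ∧ ∀ N (x y : Plane),
      ∑ k ∈ Finset.range N, ENNReal.ofReal (dyadicScale k ^ (2 - t)
        * ((dyadicScale k ^ 2)⁻¹ * if ‖x - y‖ ≤ 2 * dyadicScale k then 1 else 0))
        ≤ ENNReal.ofReal C * edist x y ^ (-t) := by
  have hl : 1 < (2 : ℝ) ^ (2 - t) := Real.one_lt_rpow (by norm_num) (by linarith)
  have hl' : 0 < (2 : ℝ) ^ (2 - t) - 1 := by linarith
  -- Here `a = 2 - t`. The `5` comes from `d² + ρ² ≤ 5ρ²` when `d ≤ 2ρ`, which compares the cutoff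
  -- with `ρ²/(d² + ρ²)`.
  refine ⟨5 * (4 * 2 ^ (2 - t) / (2 ^ (2 - t) - 1)), by positivity,
    sum_le_mul_edist_rpow (f := fun k d => dyadicScale k ^ (2 - t)
        * ((dyadicScale k ^ 2)⁻¹ * if d ≤ 2 * dyadicScale k then 1 else 0))
        (fun k d => ?_) (by positivity) (by linarith) fun N d hd => ?_⟩
  · have := dyadicScale_pos k
    positivity
  · rw [mul_comm, ← mul_assoc]
    have h := sum_dyadicScale_rpow_le (by linarith : 0 < 2 - t) (by linarith) (inv_pos.2 hd) N
    refine le_trans ?_ (mul_le_mul_of_nonneg_left h (by positivity : 0 ≤ d ^ (-t) * 5))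
    rw [Finset.mul_sum]
    refine Finset.sum_le_sum fun k _ => ?_
    have hk := dyadicScale_pos k
    rw [← div_eq_mul_inv, Real.div_rpow hk.le hd.le, Real.rpow_sub hd, Real.rpow_neg hd.le,
      Real.rpow_two]
    have hdt : 0 < d ^ t := by positivity
    have e : (d ^ t)⁻¹ * 5 * (dyadicScale k ^ (2 - t) / (d ^ 2 / d ^ t)
        / (1 + (dyadicScale k / d) ^ 2))
        = dyadicScale k ^ (2 - t) * (5 / (d ^ 2 + dyadicScale k ^ 2)) := by
      field_simp
    rw [e]
    gcongr
    split_ifs with hif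
    · rw [mul_one, inv_eq_one_div, div_le_div_iff₀ (by positivity) (by positivity)]
      nlinarith
    · rw [mul_zero]; positivity

/-! ### Duality with the measure on lines at a single scale -/

/-- The square with lower left corner `(q 0, q 1)` and side `ρ`. -/
def cornerSquare (ρ : ℝ) (q : Plane) : Set (ℝ × ℝ) :=
  Set.Icc (q 0) (q 0 + ρ) ×ˢ Set.Icc (q 1) (q 1 + ρ)

lemma measurableSet_cornerSquare (ρ : ℝ) (q : Plane) : MeasurableSet (cornerSquare ρ q) :=
  measurableSet_Icc.prod measurableSet_Icc

lemma volume_cornerSquare (ρ : ℝ) (q : Plane) :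
    volume (cornerSquare ρ q) = ENNReal.ofReal ρ ^ 2 := by
  rw [cornerSquare, Measure.volume_eq_prod, Measure.prod_prod]
  simp [sq]

lemma measurableSet_mem_cornerSquare (ρ : ℝ) :
    MeasurableSet {z : (ℝ × ℝ) × Plane | z.1 ∈ cornerSquare ρ z.2} := by
  have : {z : (ℝ × ℝ) × Plane | z.1 ∈ cornerSquare ρ z.2}
      = {z | z.2 0 ≤ z.1.1} ∩ {z | z.1.1 ≤ z.2 0 + ρ} ∩ ({z | z.2 1 ≤ z.1.2}
        ∩ {z | z.1.2 ≤ z.2 1 + ρ}) := by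
    ext z; rfl
  rw [this]
  exact (((isClosed_le (by fun_prop) (by fun_prop)).inter
    (isClosed_le (by fun_prop) (by fun_prop))).inter
    ((isClosed_le (by fun_prop) (by fun_prop)).inter
    (isClosed_le (by fun_prop) (by fun_prop)))).measurableSet

lemma norm_sub_le_of_mem_cornerSquare {ρ : ℝ} (hρ : 0 ≤ ρ) {q q' : Plane} {x : ℝ × ℝ}
    (h : x ∈ cornerSquare ρ q) (h' : x ∈ cornerSquare ρ q') : ‖q - q'‖ ≤ 2 * ρ := by
  obtain ⟨⟨a1, a2⟩, a3, a4⟩ := h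
  obtain ⟨⟨b1, b2⟩, b3, b4⟩ := h'
  refine abs_le_of_sq_le_sq' ?_ (by positivity) |>.2
  rw [EuclideanSpace.norm_sq_eq, Fin.sum_univ_two]
  simp only [Real.norm_eq_abs, sq_abs, PiLp.sub_apply]
  have h0 : (q 0 - q' 0) ^ 2 ≤ ρ ^ 2 := sq_le_sq' (by linarith) (by linarith)
  have h1 : (q 1 - q' 1) ^ 2 ≤ ρ ^ 2 := sq_le_sq' (by linarith) (by linarith)
  nlinarith

/-- By Tonelli the left side is the integral of `S` against `ν` smeared over squares, a function;
Cauchy–Schwarz follows. The squared norm of that function sees only pairs of overlapping squares. -/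
lemma lintegral_cornerSquare_le {c : ℝ} (hc : 0 < c) {ρ : ℝ} (hρ : 0 < ρ) (hρ1 : ρ ≤ 1)
    {ν : Measure Plane} [IsFiniteMeasure ν] (hν : ν (paramRect c)ᶜ = 0) {S : ℝ × ℝ → ℝ≥0∞}
    (hS : Measurable S) :
    ∫⁻ q, (∫⁻ x in cornerSquare ρ q, S x) ∂ν
      ≤ (∫⁻ x in Set.Icc (0 : ℝ) 2 ×ˢ Set.univ, S x ^ 2) ^ (1 / 2 : ℝ)
        * (ENNReal.ofReal ρ ^ 2 *
          ∫⁻ q, ∫⁻ q', (if ‖q - q'‖ ≤ 2 * ρ then 1 else 0) ∂ν ∂ν) ^ (1 / 2 : ℝ) := by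
  set D : Set (ℝ × ℝ) := Set.Icc (0 : ℝ) 2 ×ˢ Set.univ
  set T : ℝ × ℝ → Plane → ℝ≥0∞ := fun x q => (cornerSquare ρ q).indicator (fun _ => 1) x with hT
  have hTm : Measurable fun z : (ℝ × ℝ) × Plane => T z.1 z.2 :=
    (measurable_const (a := (1 : ℝ≥0∞))).indicator (measurableSet_mem_cornerSquare ρ)
  have hT1 : ∀ x, Measurable (T x) := fun x => hTm.comp measurable_prodMk_left
  set g : ℝ × ℝ → ℝ≥0∞ := fun x => ∫⁻ q, T x q ∂ν with hg
  have hgm : Measurable g := hTm.lintegral_prod_right'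
  have hsub : ∀ᵐ q ∂ν, cornerSquare ρ q ⊆ D := by
    refine (measure_eq_zero_iff_ae_notMem.1 hν).mono fun q hq x hx => ?_
    have hq' : q ∈ paramRect c := by simpa using hq
    obtain ⟨⟨h1, h2⟩, -⟩ := hq'
    obtain ⟨⟨h3, h4⟩, -⟩ := hx
    exact ⟨⟨by linarith, by linarith⟩, trivial⟩
  have h1 : ∫⁻ q, (∫⁻ x in cornerSquare ρ q, S x) ∂ν = ∫⁻ q, (∫⁻ x in D, S x * T x q) ∂ν := by
    refine lintegral_congr_ae (hsub.mono fun q hq => ?_)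
    have : ∀ x, S x * T x q = (cornerSquare ρ q).indicator S x := by
      intro x
      by_cases h : x ∈ cornerSquare ρ q <;> simp [hT, h]
    simp only [this]
    rw [lintegral_indicator (measurableSet_cornerSquare ρ q),
      Measure.restrict_restrict (measurableSet_cornerSquare ρ q), Set.inter_eq_left.2 hq]
  have h2 : ∫⁻ q, (∫⁻ x in D, S x * T x q) ∂ν = ∫⁻ x in D, S x * g x := by
    rw [lintegral_lintegral_swap]
    · refine lintegral_congr fun x => ?_
      rw [lintegral_const_mul _ (hT1 x)]
    · exact ((hS.comp measurable_snd).mul (hTm.comp measurable_swap)).aemeasurable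
  have hTT : ∀ q q', ∫⁻ x, T x q * T x q'
      ≤ ENNReal.ofReal ρ ^ 2 * (if ‖q - q'‖ ≤ 2 * ρ then 1 else 0) := by
    intro q q'
    split_ifs with h
    · calc ∫⁻ x, T x q * T x q' ≤ ∫⁻ x, T x q := by
            refine lintegral_mono fun x => ?_
            refine mul_le_of_le_one_right' ?_
            exact Set.indicator_le_self' (fun _ _ => zero_le) _
        _ = ENNReal.ofReal ρ ^ 2 * 1 := by
            rw [mul_one, ← volume_cornerSquare ρ q]
            exact lintegral_indicator_one (measurableSet_cornerSquare ρ q)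
    · rw [mul_zero, nonpos_iff_eq_zero]
      have : ∀ x, T x q * T x q' = 0 := by
        intro x
        simp only [hT]
        by_cases h1 : x ∈ cornerSquare ρ q
        · by_cases h2 : x ∈ cornerSquare ρ q'
          · exact absurd (norm_sub_le_of_mem_cornerSquare hρ.le h1 h2) h
          · simp [h2]
        · simp [h1]
      simp [this]
  have hg2 : ∫⁻ x in D, g x ^ 2
      ≤ ENNReal.ofReal ρ ^ 2 * ∫⁻ q, ∫⁻ q', (if ‖q - q'‖ ≤ 2 * ρ then 1 else 0) ∂ν ∂ν := by
    have hm3 : Measurable fun z : (ℝ × ℝ) × Plane × Plane => T z.1 z.2.1 * T z.1 z.2.2 :=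
      (hTm.comp (by fun_prop : Measurable fun z : (ℝ × ℝ) × Plane × Plane => (z.1, z.2.1))).mul
        (hTm.comp (by fun_prop : Measurable fun z : (ℝ × ℝ) × Plane × Plane => (z.1, z.2.2)))
    have hgg : ∀ x, g x ^ 2 = ∫⁻ y : Plane × Plane, T x y.1 * T x y.2 ∂(ν.prod ν) := by
      intro x
      rw [lintegral_prod_mul (hT1 x).aemeasurable (hT1 x).aemeasurable, sq]
    calc ∫⁻ x in D, g x ^ 2 ≤ ∫⁻ x, g x ^ 2 := setLIntegral_le_lintegral _ _
      _ = ∫⁻ y : Plane × Plane, (∫⁻ x, T x y.1 * T x y.2) ∂(ν.prod ν) := by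
          simp only [hgg]
          exact lintegral_lintegral_swap hm3.aemeasurable
      _ ≤ ∫⁻ y : Plane × Plane, ENNReal.ofReal ρ ^ 2 *
          (if ‖y.1 - y.2‖ ≤ 2 * ρ then 1 else 0) ∂(ν.prod ν) :=
          lintegral_mono fun y => hTT y.1 y.2
      _ = _ := by
          have hm : Measurable fun y : Plane × Plane =>
              (if ‖y.1 - y.2‖ ≤ 2 * ρ then 1 else 0 : ℝ≥0∞) :=
            Measurable.ite (isClosed_le (by fun_prop) (by fun_prop)).measurableSet
              measurable_const measurable_const
          rw [lintegral_const_mul _ hm, lintegral_prod _ hm.aemeasurable]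
  rw [h1, h2]
  clear_value T g D
  have hCS := ENNReal.lintegral_mul_le_Lp_mul_Lq (volume.restrict D)
    Real.HolderConjugate.two_two hS.aemeasurable hgm.aemeasurable
  simp only [ENNReal.rpow_two] at hCS
  exact hCS.trans (by gcongr)

lemma rpow_half_mul_rpow_half {w w' : ℝ} (hw : 0 < w) (h : w * w' = 1) (A B : ℝ≥0∞) :
    (ENNReal.ofReal w * A) ^ (1 / 2 : ℝ) * (ENNReal.ofReal w' * B) ^ (1 / 2 : ℝ)
      = A ^ (1 / 2 : ℝ) * B ^ (1 / 2 : ℝ) := by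
  rw [← ENNReal.mul_rpow_of_nonneg _ _ (by norm_num), ← ENNReal.mul_rpow_of_nonneg _ _ (by norm_num),
    mul_mul_mul_comm, ← ENNReal.ofReal_mul hw.le, h, ENNReal.ofReal_one, one_mul]

/-- With `ζ = α'`, the kernels `ζ`, `ζ'`, `ζ''` in `lineTransformSum` are all derivatives of
compactly supported functions, so the `L²` bound covers each. The last one uses `α''` as a `C²`
function, hence `C⁴`. -/
lemma exists_lintegral_lineTransform_le {α : ℝ → ℝ} (hα : ContDiff ℝ 4 α)
    (hc : HasCompactSupport α) :
    ∃ C : ℝ, 0 < C ∧ ∀ ρ, 0 < ρ → ρ ≤ 1 → ∀ c, 0 < c → ∀ (μ ν : Measure Plane)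
      [IsFiniteMeasure μ] [IsFiniteMeasure ν],
      μ (Metric.closedBall (0 : Plane) 1)ᶜ = 0 → ν (paramRect c)ᶜ = 0 →
      ∫⁻ q, ‖lineTransform (deriv α) 0 ρ μ (q 0, q 1)‖ₑ ∂ν
        ≤ (ENNReal.ofReal C * ∫⁻ p, ∫⁻ q, ENNReal.ofReal (ρ / (ρ ^ 2 + ‖p - q‖ ^ 2)) ∂μ ∂μ)
            ^ (1 / 2 : ℝ)
          * (∫⁻ p, ∫⁻ q, ENNReal.ofReal ((ρ ^ 2)⁻¹ * if ‖p - q‖ ≤ 2 * ρ then 1 else 0) ∂ν ∂ν)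
            ^ (1 / 2 : ℝ) := by
  have hα1 : ContDiff ℝ 3 (deriv α) := ContDiff.deriv' (n := 3) (hα.of_le (by norm_num))
  have hα2 : ContDiff ℝ 2 (deriv (deriv α)) := ContDiff.deriv' (n := 2) (hα1.of_le (by norm_num))
  have hα1' : ContDiff ℝ 2 (deriv α) := hα1.of_le (by norm_num)
  obtain ⟨C0, p0, h0⟩ := exists_lintegral_lineTransform_sq_le (hα.of_le (by norm_num)) hc
    (i := 0) (by norm_num)
  obtain ⟨C1, p1, h1⟩ := exists_lintegral_lineTransform_sq_le hα1' hc.deriv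
    (i := 0) (by norm_num)
  obtain ⟨C2, p2, h2⟩ := exists_lintegral_lineTransform_sq_le hα1' hc.deriv
    (i := 1) (by norm_num)
  obtain ⟨C3, p3, h3⟩ := exists_lintegral_lineTransform_sq_le hα2 hc.deriv.deriv
    (i := 1) (by norm_num)
  -- The `16` comes from squaring a sum of four terms; the `+ 1` only makes the constant positive.
  refine ⟨16 * (C0 + C1 + C2 + C3) + 1, by positivity, fun ρ hρ hρ1 c hc0 μ ν _ _ hμ hν => ?_⟩
  set A := ∫⁻ p, ∫⁻ q, ENNReal.ofReal (ρ / (ρ ^ 2 + ‖p - q‖ ^ 2)) ∂μ ∂μ with hA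
  set N : ℝ≥0∞ := ∫⁻ q, ∫⁻ q', (if ‖q - q'‖ ≤ 2 * ρ then 1 else 0) ∂ν ∂ν with hN
  have hconst : ∀ C : ℝ, 0 ≤ C → ∫⁻ p, ∫⁻ q, ENNReal.ofReal (C * (ρ / (ρ ^ 2 + ‖p - q‖ ^ 2))) ∂μ ∂μ
      = ENNReal.ofReal C * A := by
    intro C hC
    simp only [ENNReal.ofReal_mul hC]
    simp only [lintegral_const_mul' _ _ ENNReal.ofReal_ne_top, hA]
  replace h0 := (h0 ρ hρ hρ1 μ hμ).trans_eq (hconst C0 p0)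
  replace h1 := (h1 ρ hρ hρ1 μ hμ).trans_eq (hconst C1 p1)
  replace h2 := (h2 ρ hρ hρ1 μ hμ).trans_eq (hconst C2 p2)
  replace h3 := (h3 ρ hρ hρ1 μ hμ).trans_eq (hconst C3 p3)
  have m0 := measurable_lineTransform hα1.continuous 0 ρ μ
  have m1 := measurable_lineTransform hα2.continuous 0 ρ μ
  have m2 := measurable_lineTransform hα2.continuous 1 ρ μ
  have m3 := measurable_lineTransform (hα2.continuous_deriv (by norm_num)) 1 ρ μ
  have hSm : Measurable (lineTransformSum (deriv α) ρ μ) := by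
    unfold lineTransformSum; fun_prop
  have hsq2 : ∀ a b : ℝ≥0∞, (a + b) ^ 2 ≤ 4 * (a ^ 2 + b ^ 2) := by
    intro a b
    rcases le_total a b with h | h
    · calc (a + b) ^ 2 ≤ (b + b) ^ 2 := by gcongr
        _ = 4 * b ^ 2 := by ring
        _ ≤ _ := by gcongr; exact le_add_self
    · calc (a + b) ^ 2 ≤ (a + a) ^ 2 := by gcongr
        _ = 4 * a ^ 2 := by ring
        _ ≤ _ := by gcongr; exact le_self_add
  have hsq : ∀ a b c d : ℝ≥0∞, (a + b + (c + d)) ^ 2 ≤ 16 * (a ^ 2 + b ^ 2 + (c ^ 2 + d ^ 2)) := by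
    intro a b c d
    calc (a + b + (c + d)) ^ 2 ≤ 4 * ((a + b) ^ 2 + (c + d) ^ 2) := hsq2 _ _
      _ ≤ 4 * (4 * (a ^ 2 + b ^ 2) + 4 * (c ^ 2 + d ^ 2)) := by gcongr <;> exact hsq2 _ _
      _ = _ := by ring
  have hS2 : ∫⁻ x in Set.Icc (0 : ℝ) 2 ×ˢ Set.univ, lineTransformSum (deriv α) ρ μ x ^ 2
      ≤ ENNReal.ofReal (16 * (C0 + C1 + C2 + C3) + 1) * A := by
    calc _ ≤ ∫⁻ x in Set.Icc (0 : ℝ) 2 ×ˢ Set.univ,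
          16 * (‖lineTransform (deriv α) 0 ρ μ x‖ₑ ^ 2
            + ‖lineTransform (deriv (deriv α)) 0 ρ μ x‖ₑ ^ 2
            + (‖lineTransform (deriv (deriv α)) 1 ρ μ x‖ₑ ^ 2
            + ‖lineTransform (deriv (deriv (deriv α))) 1 ρ μ x‖ₑ ^ 2)) :=
          lintegral_mono fun x => hsq _ _ _ _
      _ ≤ 16 * (ENNReal.ofReal C0 * A + ENNReal.ofReal C1 * A
          + (ENNReal.ofReal C2 * A + ENNReal.ofReal C3 * A)) := by
          rw [lintegral_const_mul' _ _ (by norm_num), lintegral_add_left (by fun_prop),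
            lintegral_add_left (by fun_prop), lintegral_add_left (by fun_prop)]
          gcongr
      _ = ENNReal.ofReal (16 * (C0 + C1 + C2 + C3)) * A := by
          rw [ENNReal.ofReal_mul (by norm_num), ENNReal.ofReal_add (by positivity) p3,
            ENNReal.ofReal_add (by positivity) p2, ENNReal.ofReal_add p0 p1]
          norm_num
          ring
      _ ≤ _ := by gcongr; linarith
  have hpt : ∀ q : Plane, ‖lineTransform (deriv α) 0 ρ μ (q 0, q 1)‖ₑ
      ≤ ENNReal.ofReal ((ρ ^ 2)⁻¹) * ∫⁻ x in cornerSquare ρ q, lineTransformSum (deriv α) ρ μ x := by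
    intro q
    have h := sq_mul_enorm_lineTransform_le hα1' hc.deriv hρ hμ (q 0) (q 1)
    refine le_trans (le_of_eq ?_) (mul_le_mul_right h (ENNReal.ofReal ((ρ ^ 2)⁻¹)))
    rw [← mul_assoc, ← ENNReal.ofReal_pow hρ.le, ← ENNReal.ofReal_mul (by positivity),
      inv_mul_cancel₀ (by positivity), ENNReal.ofReal_one, one_mul]
  have hB : ∫⁻ p, ∫⁻ q, ENNReal.ofReal ((ρ ^ 2)⁻¹ * if ‖p - q‖ ≤ 2 * ρ then 1 else 0) ∂ν ∂ν
      = ENNReal.ofReal ((ρ ^ 2)⁻¹) * N := by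
    have : ∀ p q : Plane, ENNReal.ofReal ((ρ ^ 2)⁻¹ * if ‖p - q‖ ≤ 2 * ρ then 1 else 0)
        = ENNReal.ofReal ((ρ ^ 2)⁻¹) * (if ‖p - q‖ ≤ 2 * ρ then 1 else 0) := by
      intro p q
      split_ifs <;> simp
    simp only [this]
    simp only [lintegral_const_mul' _ _ ENNReal.ofReal_ne_top, hN]
  rw [hB]
  calc _ ≤ ∫⁻ q, ENNReal.ofReal ((ρ ^ 2)⁻¹)
        * (∫⁻ x in cornerSquare ρ q, lineTransformSum (deriv α) ρ μ x) ∂ν := lintegral_mono hpt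
    _ = ENNReal.ofReal ((ρ ^ 2)⁻¹)
        * ∫⁻ q, (∫⁻ x in cornerSquare ρ q, lineTransformSum (deriv α) ρ μ x) ∂ν :=
        lintegral_const_mul' _ _ ENNReal.ofReal_ne_top
    _ ≤ ENNReal.ofReal ((ρ ^ 2)⁻¹)
        * ((ENNReal.ofReal (16 * (C0 + C1 + C2 + C3) + 1) * A) ^ (1 / 2 : ℝ)
          * (ENNReal.ofReal ρ ^ 2 * N) ^ (1 / 2 : ℝ)) := by
        gcongr
        refine (lintegral_cornerSquare_le hc0 hρ hρ1 hν hSm).trans ?_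
        gcongr
    _ = _ := by
        rw [mul_left_comm]
        congr 1
        have e : ENNReal.ofReal ((ρ ^ 2)⁻¹)
            = (ENNReal.ofReal ((ρ ^ 2)⁻¹) ^ 2) ^ (1 / 2 : ℝ) := by
          rw [← ENNReal.rpow_natCast, ← ENNReal.rpow_mul]; norm_num
        conv_lhs => rw [e]
        rw [← ENNReal.mul_rpow_of_nonneg _ _ (by norm_num), ← mul_assoc,
          ← ENNReal.ofReal_pow hρ.le, ← ENNReal.ofReal_pow (by positivity),
          ← ENNReal.ofReal_mul (by positivity)]
        congr 3
        field_simp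

/-! ### Comparison with Riesz energies -/

lemma sum_lintegral_le_rieszEnergy {N : ℕ} {f : ℕ → Plane → Plane → ℝ≥0∞}
    (hf : ∀ k, Measurable fun z : Plane × Plane => f k z.1 z.2) {C s : ℝ}
    (h : ∀ x y, ∑ k ∈ Finset.range N, f k x y ≤ ENNReal.ofReal C * edist x y ^ (-s))
    (σ : Measure Plane) [IsFiniteMeasure σ] :
    ∑ k ∈ Finset.range N, ∫⁻ x, ∫⁻ y, f k x y ∂σ ∂σ ≤ ENNReal.ofReal C * rieszEnergy s σ := by
  rw [← lintegral_finsetSum _ fun k _ => (hf k).lintegral_prod_right', rieszEnergy,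
    ← lintegral_const_mul' _ _ ENNReal.ofReal_ne_top]
  refine lintegral_mono fun x => ?_
  have hx : ∀ k, Measurable (f k x) := fun k => (hf k).comp measurable_prodMk_left
  rw [← lintegral_finsetSum _ fun k _ => hx k,
    ← lintegral_const_mul' _ _ ENNReal.ofReal_ne_top]
  exact lintegral_mono fun y => h x y

/-- Points of norm at most `2` are at distance at most `4`, so the Riesz kernel is at least
`4^(-s)`. This handles the coarsest scale, where there is no cancellation. -/
lemma measure_univ_sq_le_rieszEnergy {s : ℝ} (hs : 0 < s) (σ : Measure Plane) [IsFiniteMeasure σ]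
    (h : ∀ᵐ x ∂σ, ‖x‖ ≤ 2) :
    σ Set.univ ^ 2 ≤ ENNReal.ofReal (4 ^ s) * rieszEnergy s σ := by
  have hpt : ∀ x y : Plane, ‖x‖ ≤ 2 → ‖y‖ ≤ 2 → 1 ≤ ENNReal.ofReal (4 ^ s) * edist x y ^ (-s) := by
    intro x y hx hy
    rcases eq_or_ne x y with rfl | hxy
    · rw [edist_self, ENNReal.zero_rpow_of_neg (by linarith),
        ENNReal.mul_top (by simp; positivity)]
      exact le_top
    · have hd : 0 < ‖x - y‖ := norm_pos_iff.2 (sub_ne_zero.2 hxy)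
      have h4 : ‖x - y‖ ≤ 4 := (norm_sub_le x y).trans (by linarith)
      rw [edist_rpow_neg_eq hxy, ← ENNReal.ofReal_mul (by positivity), ← ENNReal.ofReal_one]
      refine ENNReal.ofReal_le_ofReal ?_
      rw [Real.rpow_neg hd.le, ← div_eq_mul_inv, one_le_div (by positivity)]
      exact Real.rpow_le_rpow hd.le h4 hs.le
  calc σ Set.univ ^ 2 = ∫⁻ _, ∫⁻ _, 1 ∂σ ∂σ := by simp [sq]
    _ ≤ ∫⁻ x, ∫⁻ y, ENNReal.ofReal (4 ^ s) * edist x y ^ (-s) ∂σ ∂σ :=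
        lintegral_mono_ae (h.mono fun x hx => lintegral_mono_ae (h.mono fun y hy => hpt x y hx hy))
    _ = _ := by simp only [lintegral_const_mul' _ _ ENNReal.ofReal_ne_top, rieszEnergy]

lemma ae_norm_le_two_of_paramRect {c : ℝ} (hc : 0 < c) {ν : Measure Plane}
    (hν : ν (paramRect c)ᶜ = 0) : ∀ᵐ q ∂ν, ‖q‖ ≤ 2 := by
  refine (measure_eq_zero_iff_ae_notMem.1 hν).mono fun q hq => ?_
  have hq' : q ∈ paramRect c := by simpa using hq
  obtain ⟨⟨h1, h2⟩, h3, h4⟩ := hq'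
  refine abs_le_of_sq_le_sq' ?_ (by norm_num) |>.2
  rw [EuclideanSpace.norm_sq_eq, Fin.sum_univ_two]
  simp only [Real.norm_eq_abs, sq_abs]
  nlinarith

/-! ### Telescoping decomposition of the tube -/

/-- The smooth bump function used to mollify tubes. -/
noncomputable def tubeBump : ContDiffBump (0 : ℝ) := ⟨1, 2, by norm_num, by norm_num⟩

lemma tubeBump_eq_one {x : ℝ} (hx : |x| ≤ 1) : tubeBump x = 1 :=
  tubeBump.one_of_mem_closedBall (by simpa [tubeBump] using hx)

lemma tubeBump_eq_zero {x : ℝ} (hx : 2 ≤ |x|) : tubeBump x = 0 :=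
  tubeBump.zero_of_le_dist (by simpa [tubeBump] using hx)

/-- A compactly supported antiderivative of the difference of two rescalings of the bump. -/
noncomputable def tubePotential (x : ℝ) : ℝ :=
  (∫ s in (0 : ℝ)..x, tubeBump s) - ∫ s in (0 : ℝ)..(x / 2), tubeBump s

lemma hasDerivAt_tubePotential (x : ℝ) :
    HasDerivAt tubePotential (tubeBump x - 1 / 2 * tubeBump (x / 2)) x := by
  have h : ∀ y, HasDerivAt (fun x => ∫ s in (0 : ℝ)..x, tubeBump s) (tubeBump y) y := fun y =>
    (tubeBump.continuous.integral_hasStrictDerivAt 0 y).hasDerivAt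
  refine ((h x).sub ((h (x / 2)).comp x ((hasDerivAt_id x).div_const 2))).congr_deriv ?_
  ring

lemma deriv_tubePotential :
    deriv tubePotential = fun x => tubeBump x - 1 / 2 * tubeBump (x / 2) :=
  funext fun x => (hasDerivAt_tubePotential x).deriv

lemma contDiff_tubePotential : ContDiff ℝ 4 tubePotential := by
  have h : ContDiff ℝ (3 + 1) tubePotential := by
    rw [contDiff_succ_iff_deriv, deriv_tubePotential]
    refine ⟨fun x => (hasDerivAt_tubePotential x).differentiableAt, by simp, ?_⟩
    have hb : ContDiff ℝ 3 tubeBump := tubeBump.contDiff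
    exact hb.sub (contDiff_const.mul (hb.comp (contDiff_id.div_const 2)))
  exact h.of_le (by norm_num)

lemma hasCompactSupport_tubePotential : HasCompactSupport tubePotential := by
  refine HasCompactSupport.intro (isCompact_Icc (a := (-4 : ℝ)) (b := 4)) fun x hx => ?_
  have hi : ∀ a b : ℝ, IntervalIntegrable tubeBump volume a b := fun a b =>
    tubeBump.continuous.intervalIntegrable a b
  rw [tubePotential, intervalIntegral.integral_interval_sub_left (hi _ _) (hi _ _)]
  -- The potential is the integral of the bump from `x / 2` to `x`; for `|x| > 4` this interval
  -- misses the bump's support `[-2, 2]` up to endpoints.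
  refine intervalIntegral.integral_zero_ae (Filter.Eventually.of_forall fun s hs => ?_)
  refine tubeBump_eq_zero ?_
  rw [Set.mem_Icc, not_and_or, not_le, not_le] at hx
  rw [Set.mem_uIoc] at hs
  rcases hx with hx | hx <;> rcases hs with hs | hs <;> rw [le_abs] <;>
    first
      | (left; linarith [hs.1, hs.2])
      | (right; linarith [hs.1, hs.2])

lemma enorm_lineTransform_tubeBump_one_le (μ : Measure Plane) (x : ℝ × ℝ) :
    ‖lineTransform tubeBump 0 (dyadicScale 0) μ x‖ₑ ≤ μ Set.univ := by
  refine (enorm_integral_le_lintegral_enorm _).trans ?_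
  calc _ ≤ ∫⁻ _, 1 ∂μ := by
        refine lintegral_mono fun p => ?_
        rw [Real.enorm_eq_ofReal_abs, ← ENNReal.ofReal_one]
        refine ENNReal.ofReal_le_ofReal ?_
        simp only [lineKernel, dyadicScale, pow_zero, inv_one, one_mul, mul_one, div_one]
        rw [abs_of_nonneg tubeBump.nonneg]
        exact tubeBump.le_one
    _ = _ := by simp

section
variable {μ : Measure Plane} [IsFiniteMeasure μ]

/-- The factor `1 / 2` in `deriv tubePotential` is the normalisation `(2ρ)⁻¹` relative to `ρ⁻¹`. -/
lemma lineTransform_tubePotential (hμ : μ (Metric.closedBall (0 : Plane) 1)ᶜ = 0) {ρ : ℝ}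
    (hρ : 0 < ρ) (x : ℝ × ℝ) :
    lineTransform (deriv tubePotential) 0 ρ μ x
      = lineTransform tubeBump 0 ρ μ x - lineTransform tubeBump 0 (2 * ρ) μ x := by
  have hi : ∀ ρ, 0 < ρ → Integrable (fun p => lineKernel tubeBump 0 ρ x p) μ := fun ρ hρ =>
    integrable_lineKernel tubeBump.continuous tubeBump.hasCompactSupport hρ 0 x μ hμ
  unfold lineTransform
  rw [← integral_sub (hi ρ hρ) (hi (2 * ρ) (by positivity))]
  refine integral_congr_ae (Filter.Eventually.of_forall fun p => ?_)
  simp only [lineKernel, deriv_tubePotential, pow_zero, mul_one]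
  rw [show (orthProj x.1 p - x.2) / (2 * ρ) = (orthProj x.1 p - x.2) / ρ / 2 by
    field_simp]
  field_simp

/-- Only `k = 1, …, N` enter the telescoping; the surplus term `k = 0` is harmless and keeps the
index set a plain range. -/
lemma enorm_lineTransform_dyadicScale_le (hμ : μ (Metric.closedBall (0 : Plane) 1)ᶜ = 0) (N : ℕ)
    (x : ℝ × ℝ) :
    ‖lineTransform tubeBump 0 (dyadicScale N) μ x‖ₑ
      ≤ ‖lineTransform tubeBump 0 (dyadicScale 0) μ x‖ₑ
        + ∑ k ∈ Finset.range (N + 1),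
          ‖lineTransform (deriv tubePotential) 0 (dyadicScale k) μ x‖ₑ := by
  induction N with
  | zero => exact le_self_add
  | succ N ih =>
    have h := lineTransform_tubePotential hμ (dyadicScale_pos (N + 1)) x
    rw [← dyadicScale_succ] at h
    rw [Finset.sum_range_succ, ← add_assoc,
      show lineTransform tubeBump 0 (dyadicScale (N + 1)) μ x
        = lineTransform tubeBump 0 (dyadicScale N) μ x
          + lineTransform (deriv tubePotential) 0 (dyadicScale (N + 1)) μ x by rw [h]; ring]
    exact (enorm_add_le _ _).trans (add_le_add ih le_rfl)

lemma weightedIncidences_le_lintegral (hμ : μ (Metric.closedBall (0 : Plane) 1)ᶜ = 0)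
    {ν : Measure Plane} [IsFiniteMeasure ν] {δ ρ : ℝ} (hρ : 0 < ρ) (hδ : δ ≤ ρ) :
    weightedIncidences δ μ ν
      ≤ ENNReal.ofReal ρ * ∫⁻ q, ‖lineTransform tubeBump 0 ρ μ (q 0, q 1)‖ₑ ∂ν := by
  have hk : ∀ q p : Plane, 0 ≤ lineKernel tubeBump 0 ρ (q 0, q 1) p := fun q p => by
    simp only [lineKernel, pow_zero, mul_one]
    exact mul_nonneg (by positivity) tubeBump.nonneg
  set E : Set (Plane × Plane) := {z | |orthProj (z.2 0) z.1 - z.2 1| ≤ δ} with hE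
  have hEm : MeasurableSet E := (isClosed_le (by simp only [orthProj_eq]; fun_prop)
    continuous_const).measurableSet
  calc weightedIncidences δ μ ν ≤ (μ.prod ν) E :=
        measure_mono fun z hz => abs_orthProj_sub_le_of_mem_deltaTube hz
    _ = ∫⁻ q, μ ((fun p => (p, q)) ⁻¹' E) ∂ν := Measure.prod_apply_symm hEm
    _ ≤ ∫⁻ q, ENNReal.ofReal ρ * ‖lineTransform tubeBump 0 ρ μ (q 0, q 1)‖ₑ ∂ν := by
        refine lintegral_mono fun q => ?_
        have hint := integrable_lineKernel tubeBump.continuous tubeBump.hasCompactSupport hρ 0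
          (q 0, q 1) μ hμ
        have h1 : ‖lineTransform tubeBump 0 ρ μ (q 0, q 1)‖ₑ
            = ∫⁻ p, ENNReal.ofReal (lineKernel tubeBump 0 ρ (q 0, q 1) p) ∂μ := by
          rw [lineTransform, Real.enorm_of_nonneg (integral_nonneg fun p => hk q p)]
          exact ofReal_integral_eq_lintegral_ofReal hint (Filter.Eventually.of_forall (hk q))
        rw [h1, ← lintegral_const_mul' _ _ ENNReal.ofReal_ne_top,
          ← lintegral_indicator_one (hEm.preimage measurable_prodMk_right)]
        refine lintegral_mono fun p => ?_
        by_cases hp : (p, q) ∈ E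
        · have hp' : |orthProj (q 0) p - q 1| ≤ δ := hp
          rw [Set.indicator_of_mem (by exact hp), ← ENNReal.ofReal_mul hρ.le, Pi.one_apply,
            ← ENNReal.ofReal_one]
          refine ENNReal.ofReal_le_ofReal (le_of_eq ?_)
          simp only [lineKernel, pow_zero, mul_one]
          rw [tubeBump_eq_one, mul_one, mul_inv_cancel₀ hρ.ne']
          rw [abs_div, abs_of_pos hρ, div_le_one hρ]
          exact hp'.trans hδ
        · rw [Set.indicator_of_notMem (by exact hp)]
          exact zero_le
    _ = _ := lintegral_const_mul' _ _ ENNReal.ofReal_ne_top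

end

/-! ### Summation over scales -/

lemma sum_rpow_half_mul_le (N : ℕ) (A B : ℕ → ℝ≥0∞) :
    ∑ k ∈ Finset.range N, A k ^ (1 / 2 : ℝ) * B k ^ (1 / 2 : ℝ)
      ≤ (∑ k ∈ Finset.range N, A k) ^ (1 / 2 : ℝ) * (∑ k ∈ Finset.range N, B k) ^ (1 / 2 : ℝ) := by
  have h := ENNReal.inner_le_Lp_mul_Lq (Finset.range N) (fun k => A k ^ (1 / 2 : ℝ))
    (fun k => B k ^ (1 / 2 : ℝ)) Real.HolderConjugate.two_two
  simpa only [← ENNReal.rpow_mul, one_div, inv_mul_cancel₀ (two_ne_zero' ℝ), ENNReal.rpow_one]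
    using h

lemma ofReal_mul_rpow_half_mul {a b : ℝ} (ha : 0 ≤ a) (hb : 0 ≤ b) (X Y : ℝ≥0∞) :
    (ENNReal.ofReal a * X) ^ (1 / 2 : ℝ) * (ENNReal.ofReal b * Y) ^ (1 / 2 : ℝ)
      = ENNReal.ofReal ((a * b) ^ (1 / 2 : ℝ)) * (X * Y) ^ (1 / 2 : ℝ) := by
  rw [← ENNReal.mul_rpow_of_nonneg _ _ (by norm_num), mul_mul_mul_comm, ← ENNReal.ofReal_mul ha,
    ENNReal.mul_rpow_of_nonneg _ _ (by norm_num),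
    ENNReal.ofReal_rpow_of_nonneg (mul_nonneg ha hb) (by norm_num)]

theorem mainTheorem2 (t : ℝ) (ht : t ∈ Set.Ioo (1 : ℝ) 2) :
    ∃ C : ℝ≥0, 0 < C ∧
      ∀ (c : ℝ), c ∈ Set.Ioo (0 : ℝ) 1 →
      ∀ (δ : ℝ), δ ∈ Set.Ioc (0 : ℝ) (c / 7) →
      ∀ (μ ν : Measure Plane) [IsFiniteMeasure μ] [IsFiniteMeasure ν],
        μ (Metric.closedBall (0 : Plane) 1)ᶜ = 0 →
        ν (paramRect c)ᶜ = 0 →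
        weightedIncidences δ μ ν ≤
          (C : ℝ≥0∞) * ENNReal.ofReal δ *
            (rieszEnergy (3 - t) μ * rieszEnergy t ν) ^ (1 / 2 : ℝ) := by
  obtain ⟨ht1, ht2⟩ := ht
  obtain ⟨C₀, p0, h0⟩ := exists_lintegral_lineTransform_le contDiff_tubePotential
    hasCompactSupport_tubePotential
  obtain ⟨C₁, p1, h1⟩ := exists_sum_poisson_le ht1 ht2
  obtain ⟨C₂, p2, h2⟩ := exists_sum_near_le ht1 ht2
  set K₁ : ℝ := (4 ^ (3 - t) * 4 ^ t) ^ (1 / 2 : ℝ) with hK1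
  set K₂ : ℝ := ((C₀ * C₁) * C₂) ^ (1 / 2 : ℝ) with hK2
  have hK1' : 0 < K₁ := by positivity
  have hK2' : 0 < K₂ := by positivity
  refine ⟨Real.toNNReal (2 * (K₁ + K₂)), by rw [Real.toNNReal_pos]; positivity,
    fun c hc δ hδ μ ν _ _ hμ hν => ?_⟩
  have hδ1 : δ ≤ 1 := hδ.2.trans (by linarith [hc.2])
  -- The stopping scale satisfies `δ ≤ 2⁻ᴺ < 2δ`, so replacing `δ` by it costs a factor `2`.
  obtain ⟨N, hN1, hN2⟩ := exists_nat_pow_near_of_lt_one hδ.1 hδ1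
    (by norm_num : (0 : ℝ) < 1 / 2) (by norm_num)
  change dyadicScale (N + 1) < δ at hN1
  change δ ≤ dyadicScale N at hN2
  set X := rieszEnergy (3 - t) μ
  set Y := rieszEnergy t ν
  set A : ℕ → ℝ≥0∞ := fun k => ∫⁻ p, ∫⁻ q, ENNReal.ofReal (dyadicScale k ^ (t - 2)
        * (dyadicScale k / (dyadicScale k ^ 2 + ‖p - q‖ ^ 2))) ∂μ ∂μ with hA
  set B : ℕ → ℝ≥0∞ := fun k => ∫⁻ p, ∫⁻ q, ENNReal.ofReal (dyadicScale k ^ (2 - t)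
        * ((dyadicScale k ^ 2)⁻¹ * if ‖p - q‖ ≤ 2 * dyadicScale k then 1 else 0)) ∂ν ∂ν with hB
  have hAsum : ∑ k ∈ Finset.range (N + 1), A k ≤ ENNReal.ofReal C₁ * X :=
    sum_lintegral_le_rieszEnergy (fun k => by fun_prop) (h1 (N + 1)) μ
  have hBsum : ∑ k ∈ Finset.range (N + 1), B k ≤ ENNReal.ofReal C₂ * Y := by
    refine sum_lintegral_le_rieszEnergy (fun k => ?_) (h2 (N + 1)) ν
    have : Measurable fun z : Plane × Plane =>
        (if ‖z.1 - z.2‖ ≤ 2 * dyadicScale k then 1 else 0 : ℝ) :=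
      Measurable.ite (isClosed_le (by fun_prop) (by fun_prop)).measurableSet
        measurable_const measurable_const
    fun_prop
  have hscale : ∀ k, ∫⁻ q, ‖lineTransform (deriv tubePotential) 0 (dyadicScale k) μ (q 0, q 1)‖ₑ ∂ν
      ≤ (ENNReal.ofReal C₀ * A k) ^ (1 / 2 : ℝ) * B k ^ (1 / 2 : ℝ) := by
    intro k
    have hk := dyadicScale_pos k
    refine (h0 _ hk (dyadicScale_le_one k) c hc.1 μ ν hμ hν).trans_eq ?_
    -- Reciprocal weights can be inserted freely at each scale; these exponents turn the two sums
    -- over `k` into Riesz kernels of order `3 - t` and `t`.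
    have hw : dyadicScale k ^ (t - 2) * dyadicScale k ^ (2 - t) = 1 := by
      rw [← Real.rpow_add hk]; simp
    rw [← rpow_half_mul_rpow_half (by positivity) hw]
    simp only [hA, hB, ENNReal.ofReal_mul (Real.rpow_nonneg hk.le _)]
    simp only [lintegral_const_mul' _ _ ENNReal.ofReal_ne_top]
    rw [mul_left_comm]
  have hmeas : ∀ k, Measurable fun q : Plane =>
      ‖lineTransform (deriv tubePotential) 0 (dyadicScale k) μ (q 0, q 1)‖ₑ := by
    intro k
    have := measurable_lineTransform (contDiff_tubePotential.continuous_deriv (by norm_num)) 0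
      (dyadicScale k) μ
    fun_prop
  have hcoarse : μ Set.univ * ν Set.univ ≤ ENNReal.ofReal K₁ * (X * Y) ^ (1 / 2 : ℝ) := by
    have hX := measure_univ_sq_le_rieszEnergy (s := 3 - t) (by linarith) μ
      ((ae_norm_le_one hμ).mono fun p hp => hp.trans (by norm_num))
    have hY := measure_univ_sq_le_rieszEnergy (s := t) (by linarith) ν
      (ae_norm_le_two_of_paramRect hc.1 hν)
    rw [hK1, ← ofReal_mul_rpow_half_mul (by positivity) (by positivity)]
    have e : ∀ a : ℝ≥0∞, a = (a ^ 2) ^ (1 / 2 : ℝ) := fun a => by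
      rw [← ENNReal.rpow_natCast, ← ENNReal.rpow_mul]; norm_num
    rw [e (μ Set.univ), e (ν Set.univ)]
    gcongr
  have hfine : ∑ k ∈ Finset.range (N + 1),
      ∫⁻ q, ‖lineTransform (deriv tubePotential) 0 (dyadicScale k) μ (q 0, q 1)‖ₑ ∂ν
        ≤ ENNReal.ofReal K₂ * (X * Y) ^ (1 / 2 : ℝ) := by
    refine (Finset.sum_le_sum fun k _ => hscale k).trans ((sum_rpow_half_mul_le _ _ _).trans ?_)
    rw [hK2, ← ofReal_mul_rpow_half_mul (by positivity) p2.le, ← Finset.mul_sum,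
      ENNReal.ofReal_mul p0.le, mul_assoc]
    gcongr
  calc weightedIncidences δ μ ν
      ≤ ENNReal.ofReal (dyadicScale N)
        * ∫⁻ q, ‖lineTransform tubeBump 0 (dyadicScale N) μ (q 0, q 1)‖ₑ ∂ν :=
        weightedIncidences_le_lintegral hμ (dyadicScale_pos N) hN2
    _ ≤ ENNReal.ofReal (2 * δ) * ∫⁻ q, (μ Set.univ + ∑ k ∈ Finset.range (N + 1),
        ‖lineTransform (deriv tubePotential) 0 (dyadicScale k) μ (q 0, q 1)‖ₑ) ∂ν := by
        gcongr with q
        · rw [dyadicScale_succ]; linarith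
        · exact (enorm_lineTransform_dyadicScale_le hμ N _).trans
            (add_le_add (enorm_lineTransform_tubeBump_one_le μ _) le_rfl)
    _ = ENNReal.ofReal (2 * δ) * (μ Set.univ * ν Set.univ + ∑ k ∈ Finset.range (N + 1),
        ∫⁻ q, ‖lineTransform (deriv tubePotential) 0 (dyadicScale k) μ (q 0, q 1)‖ₑ ∂ν) := by
        rw [lintegral_add_left measurable_const, lintegral_const,
          lintegral_finsetSum _ fun k _ => hmeas k]
    _ ≤ ENNReal.ofReal (2 * δ) * (ENNReal.ofReal K₁ * (X * Y) ^ (1 / 2 : ℝ)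
        + ENNReal.ofReal K₂ * (X * Y) ^ (1 / 2 : ℝ)) := by gcongr
    _ = _ := by
        rw [← add_mul, ← ENNReal.ofReal_add hK1'.le hK2'.le, ← mul_assoc,
          ← ENNReal.ofReal_mul (by linarith [hδ.1]),
          show 2 * δ * (K₁ + K₂) = 2 * (K₁ + K₂) * δ by ring,
          ENNReal.ofReal_mul (by positivity)]
        rfl
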